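/- Let $X,Y,Z$ be random variables with finite ranges $\mathcal X,\mathcal Y,\mathcal Z$ and joint distribution $p=p_{XYZ}$. Logarithms are to base $2$, and $\mathrm{supp}[q]=\{a: q(a)>0\}$. *Support relation.* For distributions $q_{XY},p_{XY}$ on $\mathcal X\times\mathcal Y$ write $q_{XY}\blacktriangleleft p_{XY}$ if, possibly after exchanging the roles of $X$ and $Y$ in both distributions, $\mathrm{supp}[q_X]\subseteq\mathrm{supp}[p_X]$ and at least one of the following holds: (i) $q_{XY}$ is uncorrelated, i.e. $q_{XY}=q_X\,q_Y$; (ii) $\mathrm{supp}[q_Y]\subseteq\mathrm{supp}[p_Y]$; (iii) for every $y\in\mathrm{supp}[q_Y]\setminus\mathrm{supp}[p_Y]$, $H(X|Y=y)=0$ under $q_{XY}$. *Two-way key rate.* A protocol on $n$ copies consists of the following. There is an i.i.d. source $X^nY^nZ^n\sim p_{XYZ}^{n}$; Alice holds $X^n$ and local randomness $Q_A$, and Bob holds $Y^n$ and local randomness $Q_B$, where $Q_A$, $Q_B$ and $X^nY^nZ^n$ are mutually independent. Finitely many public messages $M=(M_1,\dots,M_r)$ with finite ranges are exchanged, each $M_i$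 being either a function of $(X^n,Q_A,M_1,\dots,M_{i-1})$ or a function of $(Y^n,Q_B,M_1,\dots,M_{i-1})$. There are outputs $f=f(X^n,Q_A,M)$ and $g=g(Y^n,Q_B,M)$ and a random variable $K$, all with values in a finite set $\mathcal K$. A number $R$ is achievable if for every $\epsilon>0$ there is an $N$ such that for every $n\ge N$ some such protocol satisfies $\Pr[f=g=K]>1-\epsilon$, $\ \log|\mathcal K|-H(K|Z^nM)<\epsilon$ and $\frac1n\log|\mathcal K|\ge R$. The two-way secret key rate $K(X:Y||Z)$ is the supremum of all achievable $R$. **Theorem.** Suppose that $p_{XY|Z=z_1}\blacktriangleleft p_{XY|Z=z_0}$ for some $z_0,z_1\in\mathcal Z$ of positive probability, and that there is a pair $(x,y)\in\mathrm{supp}[p_{X|Z=z_0}]\times\mathrm{supp}[p_{Y|Z=z_0}]$ with $p(x,y|z_1)>0$ but $p(x,y|z_0)=0$. Then $$K(X:Y||Z)<I(X:Y|Z).$$ -/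

import Mathlib

open MeasureTheory ProbabilityTheory

noncomputable section

/-! ### Finite distributions and their information measures (in bits) -/

/-- The support of a distribution on a finite set. -/
def supp {α : Type*} (q : α → ℝ) : Set α := {a | 0 < q a}

/-- First marginal of a joint distribution. -/
def margFst {α β : Type*} [Fintype β] (q : α × β → ℝ) (a : α) : ℝ := ∑ b, q (a, b)

/-- Second marginal of a joint distribution. -/
def margSnd {α β : Type*} [Fintype α] (q : α × β → ℝ) (b : β) : ℝ := ∑ a, q (a, b)

/-- The conditional distribution of the first component given that the second one equals `b`.
It is meaningful when `b` has positive probability (otherwise it is the zero function). -/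
def condFst {α β : Type*} [Fintype α] (q : α × β → ℝ) (b : β) (a : α) : ℝ :=
  q (a, b) / margSnd q b

/-- Shannon entropy `H(q) = - ∑ a, q a * log₂ (q a)`, with `0 log 0 = 0`. -/
def shannonEntropy {α : Type*} [Fintype α] (q : α → ℝ) : ℝ :=
  ∑ a, Real.negMulLog (q a) / Real.log 2

/-- Conditional entropy `H(A|B) = ∑ b, q_B(b) * H(A|B=b)` of a joint distribution of `(A, B)`. -/
def condEntropy {α β : Type*} [Fintype α] [Fintype β] (q : α × β → ℝ) : ℝ :=
  ∑ b, margSnd q b * shannonEntropy (condFst q b)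

/-- Mutual information `I(A:B) = H(A) + H(B) - H(AB)`. -/
def mutualInfo {α β : Type*} [Fintype α] [Fintype β] (q : α × β → ℝ) : ℝ :=
  shannonEntropy (margFst q) + shannonEntropy (margSnd q) - shannonEntropy q

/-- The marginal `p_Z` of a distribution `p_{XYZ}`. -/
def margZ {𝒳 𝒴 𝒵 : Type*} [Fintype 𝒳] [Fintype 𝒴] (p : 𝒳 × 𝒴 × 𝒵 → ℝ) (z : 𝒵) : ℝ :=
  ∑ x, ∑ y, p (x, y, z)

/-- The conditional distribution `p_{XY|Z=z}`, meaningful when `p_Z(z) > 0`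
(otherwise it is the zero function). -/
def condXY {𝒳 𝒴 𝒵 : Type*} [Fintype 𝒳] [Fintype 𝒴] (p : 𝒳 × 𝒴 × 𝒵 → ℝ) (z : 𝒵)
    (xy : 𝒳 × 𝒴) : ℝ :=
  p (xy.1, xy.2, z) / margZ p z

/-- Conditional mutual information `I(X:Y|Z) = ∑ z, p_Z(z) * I(X:Y|Z=z)`. -/
def condMutualInfo {𝒳 𝒴 𝒵 : Type*} [Fintype 𝒳] [Fintype 𝒴] [Fintype 𝒵]
    (p : 𝒳 × 𝒴 × 𝒵 → ℝ) : ℝ :=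
  ∑ z, margZ p z * mutualInfo (condXY p z)

/-! ### The support relation between two joint distributions -/

/-- `q` makes its two components independent. -/
def Uncorrelated {𝒳 𝒴 : Type*} [Fintype 𝒳] [Fintype 𝒴] (q : 𝒳 × 𝒴 → ℝ) : Prop :=
  ∀ x y, q (x, y) = margFst q x * margSnd q y

/-- `supp q_X ⊆ supp p_X`, together with one of: (i) `q` is uncorrelated,
(ii) `supp q_Y ⊆ supp p_Y`, (iii) `H(X|Y=y) = 0` under `q` for all
`y ∈ supp q_Y \ supp p_Y`. -/
def SuppBelowFst {𝒳 𝒴 : Type*} [Fintype 𝒳] [Fintype 𝒴] (q p : 𝒳 × 𝒴 → ℝ) : Prop :=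
  supp (margFst q) ⊆ supp (margFst p) ∧
    (Uncorrelated q ∨
      supp (margSnd q) ⊆ supp (margSnd p) ∨
      ∀ y ∈ supp (margSnd q) \ supp (margSnd p), shannonEntropy (condFst q y) = 0)

/-- The relation `q_{XY} ◀ p_{XY}`: `SuppBelowFst` holds, possibly after exchanging the roles
of `X` and `Y` (in both distributions). -/
def SuppBelow {𝒳 𝒴 : Type*} [Fintype 𝒳] [Fintype 𝒴] (q p : 𝒳 × 𝒴 → ℝ) : Prop :=
  SuppBelowFst q p ∨
    SuppBelowFst (fun yx : 𝒴 × 𝒳 => q yx.swap) (fun yx : 𝒴 × 𝒳 => p yx.swap)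

/-! ### Key agreement by public discussion -/

/-- The distribution of a finitely valued random variable. -/
def law {Ω α : Type*} [MeasurableSpace Ω] (μ : Measure Ω) (U : Ω → α) (a : α) : ℝ :=
  μ.real {ω | U ω = a}

/-- `W` is a function of the finitely valued variables `U`, `V` and of the local
randomness `Q`; the function is measurable in `Q`. -/
def IsFunctionOf {Ω α 𝒬 β γ : Type*} [MeasurableSpace 𝒬]
    (U : Ω → α) (Q : Ω → 𝒬) (V : Ω → β) (W : Ω → γ) : Prop :=
  ∃ φ : α → 𝒬 → β → γ,
    (∀ a b c, MeasurableSet {q | φ a q b = c}) ∧ ∀ ω, W ω = φ (U ω) (Q ω) (V ω)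

/-- A two-way key agreement protocol on `n` independent copies of the source `p_{XYZ}`: all
random variables live on one probability space `Ω`. Local randomness is arbitrary, the message
alphabet `Msg` and the key alphabet `Key` are finite. -/
structure KeyProtocol {𝒳 𝒴 𝒵 : Type*} (p : 𝒳 × 𝒴 × 𝒵 → ℝ) (n : ℕ) where
  /-- The probability space. -/
  Ω : Type
  [measurableSpaceΩ : MeasurableSpace Ω]
  μ : Measure Ω
  [isProbabilityMeasure : IsProbabilityMeasure μ]
  /-- Alice's, Bob's and Eve's source sequences `X^n`, `Y^n`, `Z^n`. -/
  X : Ω → Fin n → 𝒳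
  Y : Ω → Fin n → 𝒴
  Z : Ω → Fin n → 𝒵
  measurable_source : ∀ x y z, MeasurableSet {ω | (X ω, Y ω, Z ω) = (x, y, z)}
  /-- The source is i.i.d. with single-copy distribution `p`. -/
  law_source : ∀ x y z, law μ (fun ω => (X ω, Y ω, Z ω)) (x, y, z) = ∏ i, p (x i, y i, z i)
  /-- The local random variables `Q_A` and `Q_B`. -/
  RangeA : Type
  RangeB : Type
  [measurableSpaceA : MeasurableSpace RangeA]
  [measurableSpaceB : MeasurableSpace RangeB]
  QA : Ω → RangeA
  QB : Ω → RangeB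
  measurable_QA : Measurable QA
  measurable_QB : Measurable QB
  /-- `Q_A`, `Q_B` and `X^n Y^n Z^n` are mutually independent. -/
  indep : iIndep ![MeasurableSpace.comap QA measurableSpaceA,
    MeasurableSpace.comap QB measurableSpaceB,
    MeasurableSpace.comap (fun ω => (X ω, Y ω, Z ω)) ⊤] μ
  /-- The public messages `M_1, …, M_r`. -/
  rounds : ℕ
  Msg : Type
  [fintypeMsg : Fintype Msg]
  M : Fin rounds → Ω → Msg
  /-- In each round, one of the parties sends a function of its source sequence, its local
  randomness and the previous messages. -/
  isMessage : ∀ i : Fin rounds,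
    IsFunctionOf X QA (fun ω (j : Fin i) => M (j.castLE i.isLt.le) ω) (M i) ∨
    IsFunctionOf Y QB (fun ω (j : Fin i) => M (j.castLE i.isLt.le) ω) (M i)
  /-- The ideal key `K`, an arbitrary random variable with range in `Key`. -/
  Key : Type
  [fintypeKey : Fintype Key]
  K : Ω → Key
  measurable_K : ∀ k, MeasurableSet {ω | K ω = k}
  /-- Alice's and Bob's outputs `f(X^n, Q_A, M)` and `g(Y^n, Q_B, M)`. -/
  f : Ω → Key
  g : Ω → Key
  isOutput_f : IsFunctionOf X QA (fun ω i => M i ω) f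
  isOutput_g : IsFunctionOf Y QB (fun ω i => M i ω) g

attribute [instance] KeyProtocol.measurableSpaceΩ KeyProtocol.isProbabilityMeasure
  KeyProtocol.fintypeMsg KeyProtocol.fintypeKey

/-- `H(K | Z^n M)`: Eve's uncertainty about the key, given her source sequence and all public
messages. -/
def KeyProtocol.eveEntropy {𝒳 𝒴 𝒵 : Type*} [Fintype 𝒵] {p : 𝒳 × 𝒴 × 𝒵 → ℝ} {n : ℕ}
    (P : KeyProtocol p n) : ℝ :=
  condEntropy (law P.μ (fun ω => (P.K ω, (P.Z ω, fun i => P.M i ω))))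

/-- `R` is an achievable two-way secret key rate for `p_{XYZ}`. -/
def IsAchievableKeyRate {𝒳 𝒴 𝒵 : Type*} [Fintype 𝒵] (p : 𝒳 × 𝒴 × 𝒵 → ℝ) (R : ℝ) : Prop :=
  ∀ ε : ℝ, 0 < ε → ∃ N : ℕ, ∀ n : ℕ, N ≤ n → ∃ P : KeyProtocol p n,
    1 - ε < P.μ.real {ω | P.f ω = P.K ω ∧ P.g ω = P.K ω} ∧
    Real.logb 2 (Fintype.card P.Key) - P.eveEntropy < ε ∧
    R ≤ 1 / (n : ℝ) * Real.logb 2 (Fintype.card P.Key)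

/-- The two-way secret key rate `K(X:Y||Z)`: the supremum of all achievable rates, taken in the
extended reals. -/
def twoWayKeyRate {𝒳 𝒴 𝒵 : Type*} [Fintype 𝒵] (p : 𝒳 × 𝒴 × 𝒵 → ℝ) : EReal :=
  sSup ((fun R : ℝ => (R : EReal)) '' {R | IsAchievableKeyRate p R})

end

/-!
Letting Eve pass `Z` through a channel `W` with output `J` can only help Alice and Bob, yet the
rate stays at most `I(X:Y|J)`. To see this, score a run of the protocol on the degraded source by
a likelihood ratio: if Alice's output agrees with Bob's, the score is the inverse of the
probability with which an observer of `J` and the transcript guesses that output, and otherwise it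
is `1`. A run that succeeds scores about as many bits as the key is secret, whereas the expected
score is bounded when `X` and `Y` are resampled independently given `J`: public discussion acts on
the two sides separately, hence preserves this independence, and independent outputs agree no more
often than the guess succeeds. By the variational formula for the relative entropy the number of
bits is at most `I(X:Y|J)` plus a constant, and on `n` copies this information is additive.

It remains to find a channel with `I(X:Y|J) < I(X:Y|Z)`. Send `z₁` to `z₀` with a small probability
`δ`. Every symbol that is new to the distribution given `z₀` changes an entropy by its mass times
`δ log (1/δ)`, to leading order. Under the support relation the pairs of old symbols that are
themselves new, such as `(x, y)`, outweigh the pairs of two new symbols, of which there are none, so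
the joint entropy gains more than the marginal entropies together and the mutual information drops
at the rate `δ log (1/δ)`, which beats the linear terms.
-/

section RelativeEntropy

variable {S : Type*} [Fintype S]

/-- Relative entropy, in bits, of two families of nonnegative weights. It is only meaningful when
`r` is positive wherever `q` is, and neither family has to be normalized. -/
noncomputable def relEntropy (q r : S → ℝ) : ℝ := ∑ s, q s * Real.logb 2 (q s / r s)

theorem sum_mul_logb_le_relEntropy_add {q r T : S → ℝ} (hq : q ∈ stdSimplex ℝ S)
    (hr : ∀ s, 0 ≤ r s) (hqr : ∀ s, 0 < q s → 0 < r s) (hT : ∀ s, 0 < T s) {c : ℝ} (hc : 0 < c)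
    (hle : ∑ s, r s * T s ≤ c) :
    ∑ s, q s * Real.logb 2 (T s) ≤ relEntropy q r + Real.logb 2 c := by
  have pointwise : ∀ s, q s * Real.log (T s) ≤
      q s * Real.log (q s / r s) + q s * Real.log c + (r s * T s / c - q s) := by
    intro s
    rcases (hq.1 s).eq_or_lt with h | h
    · simpa [← h] using div_nonneg (mul_nonneg (hr s) (hT s).le) hc.le
    have hrs := hqr s h
    have hTs := hT s
    have hlog := Real.log_le_sub_one_of_pos (x := r s * T s / (q s * c)) (by positivity)
    rw [Real.log_div (by positivity) (by positivity), Real.log_mul hrs.ne' hTs.ne',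
      Real.log_mul h.ne' hc.ne'] at hlog
    rw [Real.log_div h.ne' hrs.ne']
    have hmul := mul_le_mul_of_nonneg_left hlog h.le
    have hcancel : q s * (r s * T s / (q s * c)) = r s * T s / c := by field_simp
    linarith
  have hsum := Finset.sum_le_sum fun s (_ : s ∈ Finset.univ) => pointwise s
  simp only [Finset.sum_add_distrib, Finset.sum_sub_distrib, ← Finset.sum_mul, ← Finset.sum_div,
    hq.2, one_mul] at hsum
  have hfrac : (∑ s, r s * T s) / c ≤ 1 := (div_le_one hc).2 hle
  simp only [relEntropy, Real.logb, mul_div_assoc', ← Finset.sum_div, ← add_div]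
  gcongr
  linarith

theorem relEntropy_nonneg {q r : S → ℝ} (hq : q ∈ stdSimplex ℝ S) (hr : ∀ s, 0 ≤ r s)
    (hqr : ∀ s, 0 < q s → 0 < r s) (hle : ∑ s, r s ≤ 1) : 0 ≤ relEntropy q r := by
  simpa using sum_mul_logb_le_relEntropy_add hq hr hqr (fun _ => one_pos) one_pos
    (by simpa using hle)

theorem relEntropy_comp_equiv {S' : Type*} [Fintype S'] (e : S' ≃ S) (q r : S → ℝ) :
    relEntropy (q ∘ e) (r ∘ e) = relEntropy q r :=
  e.sum_comp fun s => q s * Real.logb 2 (q s / r s)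

theorem relEntropy_mul_kernel {τ : Type*} [Fintype τ] (q r : S → ℝ) {κ : S → τ → ℝ}
    (hκ : ∀ s, κ s ∈ stdSimplex ℝ τ) :
    relEntropy (fun a : S × τ => q a.1 * κ a.1 a.2) (fun a => r a.1 * κ a.1 a.2) =
      relEntropy q r := by
  have cancel : ∀ s t, q s * κ s t * Real.logb 2 (q s * κ s t / (r s * κ s t)) =
      κ s t * (q s * Real.logb 2 (q s / r s)) := by
    intro s t
    rcases eq_or_ne (κ s t) 0 with h | h
    · simp [h]
    · rw [mul_div_mul_right _ _ h]
      ring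
  simp only [relEntropy, Fintype.sum_prod_type, cancel, ← Finset.sum_mul, (hκ _).2, one_mul]

theorem sum_mul_sum_logb_le_relEntropy_add {τ : Type*} [Fintype τ] {q r : S → ℝ}
    {κ T : S → τ → ℝ} (hq : q ∈ stdSimplex ℝ S) (hr : ∀ s, 0 ≤ r s)
    (hqr : ∀ s, 0 < q s → 0 < r s) (hκ : ∀ s, κ s ∈ stdSimplex ℝ τ) (hT : ∀ s t, 0 < T s t)
    {c : ℝ} (hc : 0 < c) (hle : ∑ s, r s * ∑ t, κ s t * T s t ≤ c) :
    ∑ s, q s * ∑ t, κ s t * Real.logb 2 (T s t) ≤ relEntropy q r + Real.logb 2 c := by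
  rw [← relEntropy_mul_kernel q r hκ]
  simp only [Finset.mul_sum, ← mul_assoc, ← Fintype.sum_prod_type'] at hle ⊢
  refine sum_mul_logb_le_relEntropy_add (T := fun a : S × τ => T a.1 a.2) ⟨?_, ?_⟩ ?_ ?_
    (fun a => hT a.1 a.2) hc hle
  · exact fun a => mul_nonneg (hq.1 _) ((hκ _).1 _)
  · simp only [Fintype.sum_prod_type, ← Finset.mul_sum, (hκ _).2, mul_one, hq.2]
  · exact fun a => mul_nonneg (hr _) ((hκ _).1 _)
  · intro a ha
    have hκa : 0 < κ a.1 a.2 := pos_of_mul_pos_right ha (hq.1 _)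
    exact mul_pos (hqr _ (pos_of_mul_pos_left ha hκa.le)) hκa

theorem relEntropy_pi {ι : Type*} [Fintype ι] [DecidableEq ι] {q r : S → ℝ}
    (hq : q ∈ stdSimplex ℝ S) (hqr : ∀ s, 0 < q s → 0 < r s) :
    relEntropy (fun s : ι → S => ∏ i, q (s i)) (fun s => ∏ i, r (s i)) =
      Fintype.card ι * relEntropy q r := by
  have split : ∀ s : ι → S,
      (∏ i, q (s i)) * Real.logb 2 ((∏ i, q (s i)) / ∏ i, r (s i)) =
        ∑ k, ∏ i, q (s i) * if i = k then Real.logb 2 (q (s i) / r (s i)) else 1 := by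
    intro s
    simp only [Finset.prod_mul_distrib, Finset.prod_ite_eq', Finset.mem_univ, if_true,
      ← Finset.mul_sum]
    by_cases h : ∃ i, q (s i) = 0
    · obtain ⟨i, hi⟩ := h
      rw [Finset.prod_eq_zero (Finset.mem_univ i) hi, zero_mul, zero_mul]
    · push Not at h
      have hpos : ∀ i, 0 < q (s i) := fun i => (hq.1 _).lt_of_ne' (h i)
      rw [← Finset.prod_div_distrib,
        Real.logb_prod _ _ fun i _ => (div_pos (hpos i) (hqr _ (hpos i))).ne']
  have marginalize : ∀ k : ι,
      ∑ s : ι → S, ∏ i, q (s i) * (if i = k then Real.logb 2 (q (s i) / r (s i)) else 1) =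
        relEntropy q r := by
    intro k
    rw [← Fintype.prod_sum (fun i t => q t * if i = k then Real.logb 2 (q t / r t) else 1),
      Fintype.prod_eq_single k fun i hi => by simp [hi, hq.2]]
    simp [relEntropy]
  simp only [relEntropy, split]
  rw [Finset.sum_comm]
  simp only [marginalize, Finset.sum_const, Finset.card_univ, nsmul_eq_mul]
  rfl

end RelativeEntropy

section Marginals

variable {α β : Type*} {q : α × β → ℝ}

section

variable [Fintype β]

theorem margFst_nonneg (hq : ∀ a, 0 ≤ q a) (x : α) : 0 ≤ margFst q x :=
  Finset.sum_nonneg fun _ _ => hq _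

theorem le_margFst (hq : ∀ a, 0 ≤ q a) (a : α × β) : q a ≤ margFst q a.1 :=
  Finset.single_le_sum (f := fun y => q (a.1, y)) (fun _ _ => hq _) (Finset.mem_univ a.2)

theorem margFst_smul (c : ℝ) (q : α × β → ℝ) : margFst (c • q) = c • margFst q := by
  ext x
  simp [margFst, Finset.mul_sum]

theorem margFst_add_smul (q₀ q₁ : α × β → ℝ) (δ : ℝ) :
    margFst (q₀ + δ • q₁) = margFst q₀ + δ • margFst q₁ := by
  ext x
  simp [margFst, Finset.sum_add_distrib, Finset.mul_sum]

end

section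

variable [Fintype α]

theorem margSnd_nonneg (hq : ∀ a, 0 ≤ q a) (y : β) : 0 ≤ margSnd q y :=
  Finset.sum_nonneg fun _ _ => hq _

theorem le_margSnd (hq : ∀ a, 0 ≤ q a) (a : α × β) : q a ≤ margSnd q a.2 :=
  Finset.single_le_sum (f := fun x => q (x, a.2)) (fun _ _ => hq _) (Finset.mem_univ a.1)

theorem margSnd_smul (c : ℝ) (q : α × β → ℝ) : margSnd (c • q) = c • margSnd q := by
  ext y
  simp [margSnd, Finset.mul_sum]

theorem margSnd_add_smul (q₀ q₁ : α × β → ℝ) (δ : ℝ) :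
    margSnd (q₀ + δ • q₁) = margSnd q₀ + δ • margSnd q₁ := by
  ext y
  simp [margSnd, Finset.sum_add_distrib, Finset.mul_sum]

end

variable [Fintype α] [Fintype β]

theorem sum_mul_comp_fst (q : α × β → ℝ) (F : α → ℝ) :
    ∑ a, q a * F a.1 = ∑ x, margFst q x * F x := by
  simp only [Fintype.sum_prod_type, margFst, Finset.sum_mul]

theorem sum_mul_comp_snd (q : α × β → ℝ) (F : β → ℝ) :
    ∑ a, q a * F a.2 = ∑ y, margSnd q y * F y := by
  simp only [Fintype.sum_prod_type_right, margSnd, Finset.sum_mul]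

theorem sum_margFst (q : α × β → ℝ) : ∑ x, margFst q x = ∑ a, q a := by
  simpa using (sum_mul_comp_fst q fun _ => 1).symm

theorem sum_margSnd (q : α × β → ℝ) : ∑ y, margSnd q y = ∑ a, q a := by
  simpa using (sum_mul_comp_snd q fun _ => 1).symm

end Marginals

section Entropy

variable {α β : Type*} [Fintype α]

theorem shannonEntropy_eq_neg_sum (q : α → ℝ) :
    shannonEntropy q = -∑ a, q a * Real.logb 2 (q a) := by
  simp only [shannonEntropy, Real.negMulLog, Real.logb, neg_mul, neg_div, mul_div_assoc,
    Finset.sum_neg_distrib]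

theorem shannonEntropy_smul (c : ℝ) (q : α → ℝ) :
    shannonEntropy (c • q) =
      c * shannonEntropy q + (∑ a, q a) * (Real.negMulLog c / Real.log 2) := by
  simp only [shannonEntropy, Pi.smul_apply, smul_eq_mul, Real.negMulLog_mul, add_div,
    Finset.sum_add_distrib, Finset.mul_sum, Finset.sum_mul, mul_div_assoc]
  rw [add_comm]

theorem shannonEntropy_le_sum_mul_neg_logb {q G : α → ℝ} (hq : q ∈ stdSimplex ℝ α)
    (hG : ∀ a, 0 < G a) (hG_sum : ∑ a, G a ≤ 1) :
    shannonEntropy q ≤ ∑ a, q a * -Real.logb 2 (G a) := by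
  have expand : ∀ a, q a * Real.logb 2 (q a / G a) =
      q a * Real.logb 2 (q a) + q a * -Real.logb 2 (G a) := by
    intro a
    rcases (hq.1 a).eq_or_lt with h | h
    · simp [← h]
    · rw [Real.logb_div h.ne' (hG a).ne']
      ring
  have hnonneg := relEntropy_nonneg hq (fun a => (hG a).le) (fun a _ => hG a) hG_sum
  simp only [relEntropy, expand, Finset.sum_add_distrib] at hnonneg
  rw [shannonEntropy_eq_neg_sum]
  linarith

theorem margSnd_mul_shannonEntropy_condFst_le {r : α × β → ℝ} (hr : ∀ a, 0 ≤ r a) (b : β)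
    {G : α → ℝ} (hG : ∀ a, 0 < G a) (hG_sum : ∑ a, G a ≤ 1) :
    margSnd r b * shannonEntropy (condFst r b) ≤ ∑ a, r (a, b) * -Real.logb 2 (G a) := by
  rcases (margSnd_nonneg hr b).eq_or_lt with h | h
  · have hzero : ∀ a, r (a, b) = 0 := fun a =>
      ((le_margSnd hr (a, b)).trans_eq h.symm).antisymm (hr _)
    simp [← h, hzero]
  · have hcond : condFst r b ∈ stdSimplex ℝ α :=
      ⟨fun a => div_nonneg (hr _) h.le, (Finset.sum_div _ _ _).symm.trans (div_self h.ne')⟩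
    calc margSnd r b * shannonEntropy (condFst r b)
        ≤ margSnd r b * ∑ a, condFst r b a * -Real.logb 2 (G a) := by
          gcongr
          exact shannonEntropy_le_sum_mul_neg_logb hcond hG hG_sum
      _ = ∑ a, r (a, b) * -Real.logb 2 (G a) := by
          simp only [Finset.mul_sum, ← mul_assoc, condFst, mul_div_cancel₀ _ h.ne']

theorem condEntropy_le_sum_mul_neg_logb [Fintype β] {D : Type*} [Fintype D] {r : α × β → ℝ}
    (hr : ∀ a, 0 ≤ r a) {W : β → D → ℝ} (hW : ∀ b, W b ∈ stdSimplex ℝ D) {G : β → D → α → ℝ}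
    (hG : ∀ b d a, 0 < G b d a) (hG_sum : ∀ b d, ∑ a, G b d a ≤ 1) :
    condEntropy r ≤ ∑ t, r t * ∑ d, W t.2 d * -Real.logb 2 (G t.2 d t.1) := by
  rw [Fintype.sum_prod_type_right]
  refine Finset.sum_le_sum fun b _ => ?_
  calc margSnd r b * shannonEntropy (condFst r b)
      = ∑ d, W b d * (margSnd r b * shannonEntropy (condFst r b)) := by
        rw [← Finset.sum_mul, (hW b).2, one_mul]
    _ ≤ ∑ d, W b d * ∑ a, r (a, b) * -Real.logb 2 (G b d a) := by
        gcongr with d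
        · exact (hW b).1 d
        · exact margSnd_mul_shannonEntropy_condFst_le hr b (hG b d) (hG_sum b d)
    _ = ∑ a, r (a, b) * ∑ d, W b d * -Real.logb 2 (G b d a) := by
        simp only [Finset.mul_sum, mul_left_comm (W b _)]
        exact Finset.sum_comm

end Entropy

section WeightedMutualInfo

variable {α β : Type*} [Fintype α] [Fintype β]

/-- The mutual information of nonnegative weights that need not sum to one: the total mass times
the mutual information of the normalized weights. -/
noncomputable def weightedMutualInfo (q : α × β → ℝ) : ℝ :=
  shannonEntropy (margFst q) + shannonEntropy (margSnd q) - shannonEntropy q -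
    Real.negMulLog (∑ a, q a) / Real.log 2

theorem weightedMutualInfo_smul (c : ℝ) (q : α × β → ℝ) :
    weightedMutualInfo (c • q) = c * weightedMutualInfo q := by
  have hsum : ∑ a, (c • q) a = c * ∑ a, q a := by simp [Finset.mul_sum]
  rw [weightedMutualInfo, hsum, margFst_smul, margSnd_smul, Real.negMulLog_mul]
  simp only [shannonEntropy_smul, sum_margFst, sum_margSnd, weightedMutualInfo]
  ring

theorem weightedMutualInfo_eq_mutualInfo {q : α × β → ℝ} (hq : ∑ a, q a = 1) :
    weightedMutualInfo q = mutualInfo q := by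
  simp [weightedMutualInfo, mutualInfo, hq]

theorem weightedMutualInfo_eq_relEntropy {q : α × β → ℝ} (hq : ∀ a, 0 ≤ q a) :
    weightedMutualInfo q =
      relEntropy q fun a => margFst q a.1 / (∑ b, q b) * margSnd q a.2 := by
  have expand : ∀ a, q a * Real.logb 2 (q a / (margFst q a.1 / (∑ b, q b) * margSnd q a.2)) =
      q a * Real.logb 2 (q a) - q a * Real.logb 2 (margFst q a.1) -
        q a * Real.logb 2 (margSnd q a.2) + q a * Real.logb 2 (∑ b, q b) := by
    intro a
    rcases (hq a).eq_or_lt with h | h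
    · simp [← h]
    · have hF := h.trans_le (le_margFst hq a)
      have hS := h.trans_le (le_margSnd hq a)
      have htotal := h.trans_le (Finset.single_le_sum (fun b _ => hq b) (Finset.mem_univ a))
      rw [Real.logb_div h.ne' (by positivity), Real.logb_mul (by positivity) hS.ne',
        Real.logb_div hF.ne' htotal.ne']
      ring
  simp only [relEntropy, expand, Finset.sum_add_distrib, Finset.sum_sub_distrib,
    sum_mul_comp_fst q fun x => Real.logb 2 (margFst q x),
    sum_mul_comp_snd q fun y => Real.logb 2 (margSnd q y), ← Finset.sum_mul]
  simp only [weightedMutualInfo, shannonEntropy_eq_neg_sum, Real.negMulLog, Real.logb]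
  ring

end WeightedMutualInfo

section Slices

variable {𝒳 𝒴 𝒵 : Type*} [Fintype 𝒳] [Fintype 𝒴] {p : 𝒳 × 𝒴 × 𝒵 → ℝ}

/-- The unnormalized conditional distribution `p_{XYZ}(·, ·, z)`, of total mass `p_Z(z)`. -/
def slice (p : 𝒳 × 𝒴 × 𝒵 → ℝ) (z : 𝒵) (xy : 𝒳 × 𝒴) : ℝ := p (xy.1, xy.2, z)

theorem sum_slice (p : 𝒳 × 𝒴 × 𝒵 → ℝ) (z : 𝒵) : ∑ a, slice p z a = margZ p z :=
  Fintype.sum_prod_type _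

theorem sum_sum_slice [Fintype 𝒵] (p : 𝒳 × 𝒴 × 𝒵 → ℝ) :
    ∑ z, ∑ a, slice p z a = ∑ a, p a := by
  simp only [Fintype.sum_prod_type, slice]
  rw [Finset.sum_comm]
  exact Finset.sum_congr rfl fun x _ => Finset.sum_comm

theorem margZ_nonneg (hp : ∀ a, 0 ≤ p a) (z : 𝒵) : 0 ≤ margZ p z :=
  Finset.sum_nonneg fun _ _ => Finset.sum_nonneg fun _ _ => hp _

theorem condXY_nonneg (hp : ∀ a, 0 ≤ p a) (z : 𝒵) (a : 𝒳 × 𝒴) : 0 ≤ condXY p z a :=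
  div_nonneg (hp _) (margZ_nonneg hp z)

theorem le_margZ (hp : ∀ a, 0 ≤ p a) (a : 𝒳 × 𝒴 × 𝒵) : p a ≤ margZ p a.2.2 := by
  rw [← sum_slice]
  exact Finset.single_le_sum (f := slice p a.2.2) (fun _ _ => hp _) (Finset.mem_univ (a.1, a.2.1))

theorem margZ_smul_condXY (hp : ∀ a, 0 ≤ p a) (z : 𝒵) : margZ p z • condXY p z = slice p z := by
  ext a
  rcases eq_or_ne (margZ p z) 0 with h | h
  · have hzero : slice p z a = 0 := ((le_margZ hp (a.1, a.2, z)).trans_eq h).antisymm (hp _)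
    simp [h, hzero]
  · exact mul_div_cancel₀ _ h

theorem sum_condXY {z : 𝒵} (hz : margZ p z ≠ 0) : ∑ a, condXY p z a = 1 := by
  change ∑ a, slice p z a / margZ p z = 1
  rw [← Finset.sum_div, sum_slice, div_self hz]

theorem condMutualInfo_eq_sum_weightedMutualInfo [Fintype 𝒵] (hp : ∀ a, 0 ≤ p a) :
    condMutualInfo p = ∑ z, weightedMutualInfo (slice p z) := by
  refine Finset.sum_congr rfl fun z _ => ?_
  rw [← margZ_smul_condXY hp, weightedMutualInfo_smul]
  rcases eq_or_ne (margZ p z) 0 with h | h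
  · simp [h]
  · rw [weightedMutualInfo_eq_mutualInfo (sum_condXY h)]

/-- The joint distribution of `(X, Y, Z)` after resampling `X` and `Y` independently given `Z`. -/
noncomputable def condIndep (p : 𝒳 × 𝒴 × 𝒵 → ℝ) (a : 𝒳 × 𝒴 × 𝒵) : ℝ :=
  margFst (slice p a.2.2) a.1 / margZ p a.2.2 * margSnd (slice p a.2.2) a.2.1

theorem slice_condIndep (p : 𝒳 × 𝒴 × 𝒵 → ℝ) (z : 𝒵) :
    slice (condIndep p) z =
      fun a => margFst (slice p z) a.1 / (∑ b, slice p z b) * margSnd (slice p z) a.2 := by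
  ext a
  rw [sum_slice]
  rfl

theorem condIndep_nonneg (hp : ∀ a, 0 ≤ p a) (a : 𝒳 × 𝒴 × 𝒵) : 0 ≤ condIndep p a :=
  mul_nonneg (div_nonneg (margFst_nonneg (fun _ => hp _) _) (margZ_nonneg hp _))
    (margSnd_nonneg (fun _ => hp _) _)

theorem condIndep_pos (hp : ∀ a, 0 ≤ p a) {a : 𝒳 × 𝒴 × 𝒵} (ha : 0 < p a) :
    0 < condIndep p a := by
  have hslice : ∀ b, 0 ≤ slice p a.2.2 b := fun _ => hp _
  have hF : 0 < margFst (slice p a.2.2) a.1 := ha.trans_le (le_margFst hslice (a.1, a.2.1))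
  have hS : 0 < margSnd (slice p a.2.2) a.2.1 := ha.trans_le (le_margSnd hslice (a.1, a.2.1))
  have hZ : 0 < margZ p a.2.2 := ha.trans_le (le_margZ hp a)
  exact mul_pos (div_pos hF hZ) hS

theorem margZ_condIndep (p : 𝒳 × 𝒴 × 𝒵 → ℝ) (z : 𝒵) : margZ (condIndep p) z = margZ p z := by
  simp only [← sum_slice, slice_condIndep, Fintype.sum_prod_type, ← Finset.mul_sum,
    ← Finset.sum_mul, ← Finset.sum_div, sum_margFst, sum_margSnd]
  simp only [← Fintype.sum_prod_type', div_mul_cancel_of_imp id]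

theorem sum_condIndep [Fintype 𝒵] (p : 𝒳 × 𝒴 × 𝒵 → ℝ) : ∑ a, condIndep p a = ∑ a, p a := by
  simp only [← sum_sum_slice, sum_slice, margZ_condIndep]

theorem condMutualInfo_eq_relEntropy [Fintype 𝒵] (hp : ∀ a, 0 ≤ p a) :
    condMutualInfo p = relEntropy p (condIndep p) := by
  rw [condMutualInfo_eq_sum_weightedMutualInfo hp]
  simp only [weightedMutualInfo_eq_relEntropy (q := slice p _) fun _ => hp _, sum_slice]
  exact sum_sum_slice fun a => p a * Real.logb 2 (p a / condIndep p a)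

end Slices

section Masses

theorem supp_smul {α : Type*} {c : ℝ} (hc : 0 < c) (p : α → ℝ) : supp (c • p) = supp p := by
  ext a
  simp [supp, hc]

variable {α β : Type*} [Fintype α] [Fintype β]

/-- The mass that `q` puts outside the support of `p`. -/
noncomputable def newMass (q p : α → ℝ) : ℝ := ∑ a, (supp p)ᶜ.indicator q a

/-- The mass that `q` puts on pairs both of whose coordinates are new to `p`. -/
noncomputable def freshMass (q p : α × β → ℝ) : ℝ :=
  ∑ a, ((supp (margFst p))ᶜ ×ˢ (supp (margSnd p))ᶜ).indicator q a

/-- The mass that `q` puts on pairs that are new to `p` although neither of their coordinates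
is. -/
noncomputable def recombinedMass (q p : α × β → ℝ) : ℝ :=
  ∑ a, ((supp (margFst p) ×ˢ supp (margSnd p)) \ supp p).indicator q a

theorem newMass_margFst (q p : α × β → ℝ) :
    newMass (margFst q) (margFst p) = ∑ a, {a : α × β | a.1 ∉ supp (margFst p)}.indicator q a := by
  classical
  simp only [newMass, Fintype.sum_prod_type, Set.indicator_apply, Set.mem_compl_iff,
    Set.mem_ofPred_eq]
  exact Finset.sum_congr rfl fun x _ => by split_ifs <;> simp [margFst]

theorem newMass_margSnd (q p : α × β → ℝ) :
    newMass (margSnd q) (margSnd p) = ∑ a, {a : α × β | a.2 ∉ supp (margSnd p)}.indicator q a := by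
  classical
  simp only [newMass, Fintype.sum_prod_type_right, Set.indicator_apply, Set.mem_compl_iff,
    Set.mem_ofPred_eq]
  exact Finset.sum_congr rfl fun y _ => by split_ifs <;> simp [margSnd]

theorem newMass_margFst_add_newMass_margSnd (q : α × β → ℝ) {p : α × β → ℝ}
    (hp : ∀ a, 0 ≤ p a) :
    newMass (margFst q) (margFst p) + newMass (margSnd q) (margSnd p) + recombinedMass q p =
      newMass q p + freshMass q p := by
  classical
  rw [newMass_margFst, newMass_margSnd, recombinedMass, newMass, freshMass,
    ← Finset.sum_add_distrib, ← Finset.sum_add_distrib, ← Finset.sum_add_distrib]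
  refine Finset.sum_congr rfl fun a _ => ?_
  have hF : a ∈ supp p → a.1 ∈ supp (margFst p) := fun h => h.trans_le (le_margFst hp a)
  have hS : a ∈ supp p → a.2 ∈ supp (margSnd p) := fun h => h.trans_le (le_margSnd hp a)
  simp only [Set.indicator_apply, Set.mem_ofPred_eq, Set.mem_sdiff, Set.mem_prod, Set.mem_compl_iff]
  by_cases h : a ∈ supp p <;> by_cases h₁ : a.1 ∈ supp (margFst p) <;>
    by_cases h₂ : a.2 ∈ supp (margSnd p) <;> simp_all

theorem sum_indicator_smul (b : ℝ) (q : α → ℝ) (s : Set α) :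
    ∑ a, s.indicator (b • q) a = b * ∑ a, s.indicator q a := by
  rw [Finset.mul_sum]
  exact Finset.sum_congr rfl fun a _ => congrFun (Set.indicator_const_smul s b q) a

theorem freshMass_smul_smul (b : ℝ) {c : ℝ} (hc : 0 < c) (q p : α × β → ℝ) :
    freshMass (b • q) (c • p) = b * freshMass q p := by
  simp only [freshMass, margFst_smul, margSnd_smul, supp_smul hc, sum_indicator_smul]

theorem recombinedMass_smul_smul (b : ℝ) {c : ℝ} (hc : 0 < c) (q p : α × β → ℝ) :
    recombinedMass (b • q) (c • p) = b * recombinedMass q p := by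
  simp only [recombinedMass, margFst_smul, margSnd_smul, supp_smul hc, sum_indicator_smul]

theorem freshMass_nonneg {q : α × β → ℝ} (hq : ∀ a, 0 ≤ q a) (p : α × β → ℝ) :
    0 ≤ freshMass q p :=
  Finset.sum_nonneg fun _ _ => Set.indicator_nonneg (fun a _ => hq a) _

theorem ne_of_freshMass_lt_recombinedMass {q p : α × β → ℝ} (hq : ∀ a, 0 ≤ q a)
    (h : freshMass q p < recombinedMass q p) : q ≠ p := by
  rintro rfl
  refine (h.trans_le (Finset.sum_nonpos fun a _ => ?_)).not_ge (freshMass_nonneg hq q)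
  exact Set.indicator_apply_nonpos fun ha => not_lt.1 ha.2

theorem sum_pos_of_freshMass_lt_recombinedMass {q p : α × β → ℝ} (hq : ∀ a, 0 ≤ q a)
    (hp : ∀ a, 0 ≤ p a) (h : freshMass q p < recombinedMass q p) : 0 < ∑ a, p a := by
  obtain ⟨a, -, ha⟩ := Finset.exists_ne_zero_of_sum_ne_zero
    ((freshMass_nonneg hq p).trans_lt h).ne'
  have hF : 0 < margFst p a.1 := (Set.mem_of_indicator_ne_zero ha).1.1
  rw [← sum_margFst]
  exact hF.trans_le (Finset.single_le_sum (fun x _ => margFst_nonneg hp x) (Finset.mem_univ a.1))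

end Masses

section Perturbation

open Filter Asymptotics Topology

variable {α β : Type*} [Fintype α] [Fintype β]

theorem negMulLog_add_mul_sub_isBigO {a : ℝ} (ha : 0 < a) (b : ℝ) :
    (fun δ => Real.negMulLog (a + δ * b) - Real.negMulLog a) =O[𝓝[>] 0] fun δ => δ := by
  have hdiff : DifferentiableAt ℝ (fun δ : ℝ => Real.negMulLog (a + δ * b)) 0 :=
    DifferentiableAt.comp (g := Real.negMulLog) _
      (by simpa using Real.differentiableAt_negMulLog ha.ne') (by fun_prop)
  simpa using hdiff.isBigO_sub.mono (nhdsWithin_le_nhds (s := Set.Ioi (0 : ℝ)))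

theorem negMulLog_mul_sub_isBigO (b : ℝ) :
    (fun δ => Real.negMulLog (δ * b) - b * Real.negMulLog δ) =O[𝓝[>] 0] fun δ => δ := by
  simpa [Real.negMulLog_mul, mul_comm] using
    (isBigO_refl (fun δ : ℝ => δ) (𝓝[>] 0)).const_mul_left (Real.negMulLog b)

/-- Only the atoms that `a` misses contribute beyond order `δ`. -/
theorem shannonEntropy_add_smul_isBigO {a : α → ℝ} (ha : ∀ i, 0 ≤ a i) (b : α → ℝ) :
    (fun δ : ℝ => shannonEntropy (a + δ • b) - shannonEntropy a -
      newMass b a * (Real.negMulLog δ / Real.log 2)) =O[𝓝[>] 0] fun δ => δ := by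
  have atom : ∀ i, (fun δ => Real.negMulLog (a i + δ * b i) - Real.negMulLog (a i) -
      (supp a)ᶜ.indicator b i * Real.negMulLog δ) =O[𝓝[>] 0] fun δ => δ := by
    intro i
    rcases (ha i).eq_or_lt with h | h
    · have hi : i ∈ (supp a)ᶜ := by simp [supp, ← h]
      simpa [← h, hi] using negMulLog_mul_sub_isBigO (b i)
    · have hi : i ∉ (supp a)ᶜ := by simpa [supp] using h
      simpa [hi] using negMulLog_add_mul_sub_isBigO h (b i)
  refine ((IsBigO.sum (s := Finset.univ) fun i _ => atom i).const_mul_left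
    (Real.log 2)⁻¹).congr_left fun δ => ?_
  simp only [shannonEntropy, newMass, Finset.sum_apply, Finset.sum_sub_distrib, ← Finset.sum_mul,
    ← Finset.sum_div, Pi.add_apply, Pi.smul_apply, smul_eq_mul]
  ring

/-- The coefficient `freshMass - recombinedMass` is the new mass in the two marginals minus the new
mass in the joint distribution. -/
theorem weightedMutualInfo_add_smul_isBigO {q₀ : α × β → ℝ} (h₀ : ∀ a, 0 ≤ q₀ a)
    (htotal : 0 < ∑ a, q₀ a) (q₁ : α × β → ℝ) :
    (fun δ : ℝ => weightedMutualInfo (q₀ + δ • q₁) - weightedMutualInfo q₀ -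
      (freshMass q₁ q₀ - recombinedMass q₁ q₀) * (Real.negMulLog δ / Real.log 2))
      =O[𝓝[>] 0] fun δ => δ := by
  have hF := shannonEntropy_add_smul_isBigO (margFst_nonneg h₀) (margFst q₁)
  have hS := shannonEntropy_add_smul_isBigO (margSnd_nonneg h₀) (margSnd q₁)
  have hjoint := shannonEntropy_add_smul_isBigO h₀ q₁
  have hmass := (negMulLog_add_mul_sub_isBigO htotal (∑ a, q₁ a)).const_mul_left (Real.log 2)⁻¹
  refine (((hF.add hS).sub hjoint).sub hmass).congr_left fun δ => ?_
  have hsum : ∑ a, (q₀ + δ • q₁) a = ∑ a, q₀ a + δ * ∑ a, q₁ a := by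
    simp [Finset.sum_add_distrib, Finset.mul_sum]
  simp only [weightedMutualInfo, margFst_add_smul, margSnd_add_smul, hsum]
  linear_combination
    (Real.negMulLog δ / Real.log 2) * -newMass_margFst_add_newMass_margSnd q₁ h₀

theorem eventually_weightedMutualInfo_add_smul_lt {q₀ q₁ : α × β → ℝ} (h₀ : ∀ a, 0 ≤ q₀ a)
    (htotal : 0 < ∑ a, q₀ a) (hmass : freshMass q₁ q₀ < recombinedMass q₁ q₀) (c : ℝ) :
    ∀ᶠ δ : ℝ in 𝓝[>] 0, weightedMutualInfo (q₀ + δ • q₁) < weightedMutualInfo q₀ + δ * c := by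
  obtain ⟨C, hC⟩ := (weightedMutualInfo_add_smul_isBigO h₀ htotal q₁).bound
  have hlog : ∀ᶠ δ : ℝ in 𝓝[>] 0,
      C - c < (recombinedMass q₁ q₀ - freshMass q₁ q₀) / Real.log 2 * -Real.log δ :=
    ((tendsto_neg_atBot_atTop.comp Real.tendsto_log_nhdsGT_zero).const_mul_atTop
      (div_pos (sub_pos.2 hmass) (Real.log_pos one_lt_two))).eventually_gt_atTop _
  filter_upwards [hC, hlog, self_mem_nhdsWithin] with δ hbound hlarge (hδ : 0 < δ)
  have hupper := (le_abs_self _).trans hbound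
  rw [Real.norm_of_nonneg hδ.le] at hupper
  have hscaled := mul_lt_mul_of_pos_left hlarge hδ
  have hrate : (freshMass q₁ q₀ - recombinedMass q₁ q₀) * (Real.negMulLog δ / Real.log 2) =
      -(δ * ((recombinedMass q₁ q₀ - freshMass q₁ q₀) / Real.log 2 * -Real.log δ)) := by
    rw [Real.negMulLog]
    ring
  linarith

end Perturbation

section Degradation

variable {𝒳 𝒴 𝒵 𝒥 : Type*} [Fintype 𝒵] {p : 𝒳 × 𝒴 × 𝒵 → ℝ} {W : 𝒵 → 𝒥 → ℝ}

/-- The joint distribution of `(X, Y, J)`, where `J` is the output of the channel `W` on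
input `Z`. -/
def degrade (p : 𝒳 × 𝒴 × 𝒵 → ℝ) (W : 𝒵 → 𝒥 → ℝ) (a : 𝒳 × 𝒴 × 𝒥) : ℝ :=
  ∑ z, p (a.1, a.2.1, z) * W z a.2.2

theorem slice_degrade (p : 𝒳 × 𝒴 × 𝒵 → ℝ) (W : 𝒵 → 𝒥 → ℝ) (j : 𝒥) :
    slice (degrade p W) j = ∑ z, W z j • slice p z := by
  ext a
  simp [slice, degrade, mul_comm]

theorem sum_degrade_mul [Fintype 𝒳] [Fintype 𝒴] [Fintype 𝒥] (p : 𝒳 × 𝒴 × 𝒵 → ℝ)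
    (W : 𝒵 → 𝒥 → ℝ) (F : 𝒳 × 𝒴 × 𝒥 → ℝ) :
    ∑ a, degrade p W a * F a =
      ∑ a : 𝒳 × 𝒴 × 𝒵, p a * ∑ j, W a.2.2 j * F (a.1, a.2.1, j) := by
  simp only [Fintype.sum_prod_type, degrade, Finset.sum_mul, Finset.mul_sum, mul_assoc]
  exact Finset.sum_congr rfl fun x _ => Finset.sum_congr rfl fun y _ => Finset.sum_comm

theorem degrade_nonneg (hp : ∀ a, 0 ≤ p a) (hW : ∀ z j, 0 ≤ W z j) (a : 𝒳 × 𝒴 × 𝒥) :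
    0 ≤ degrade p W a :=
  Finset.sum_nonneg fun _ _ => mul_nonneg (hp _) (hW _ _)

theorem degrade_mem_stdSimplex [Fintype 𝒳] [Fintype 𝒴] [Fintype 𝒥]
    (hp : p ∈ stdSimplex ℝ (𝒳 × 𝒴 × 𝒵)) (hW : ∀ z, W z ∈ stdSimplex ℝ 𝒥) :
    degrade p W ∈ stdSimplex ℝ (𝒳 × 𝒴 × 𝒥) := by
  refine ⟨degrade_nonneg hp.1 fun z => (hW z).1, ?_⟩
  simpa [(hW _).2, hp.2] using sum_degrade_mul p W fun _ => 1

end Degradation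

section MergeChannel

variable {𝒵 : Type*} [DecidableEq 𝒵]

/-- The channel that turns the symbol `z₁` into `z₀` with probability `δ` and transmits everything
else faithfully. -/
def mergeChannel (z₀ z₁ : 𝒵) (δ : ℝ) : 𝒵 → 𝒵 → ℝ :=
  Function.update (fun z => Pi.single z 1) z₁ (δ • Pi.single z₀ 1 + (1 - δ) • Pi.single z₁ 1)

variable [Fintype 𝒵] {z₀ z₁ : 𝒵} {δ : ℝ}

theorem mergeChannel_mem_stdSimplex (z₀ z₁ : 𝒵) (hδ : 0 ≤ δ) (hδ' : δ ≤ 1) (z : 𝒵) :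
    mergeChannel z₀ z₁ δ z ∈ stdSimplex ℝ 𝒵 := by
  rcases eq_or_ne z z₁ with rfl | h
  · simpa [mergeChannel] using convex_stdSimplex ℝ 𝒵 (single_mem_stdSimplex ℝ z₀)
      (single_mem_stdSimplex ℝ z) hδ (sub_nonneg.2 hδ') (add_sub_cancel δ 1)
  · simpa [mergeChannel, h] using single_mem_stdSimplex ℝ z

variable {𝒳 𝒴 : Type*} (p : 𝒳 × 𝒴 × 𝒵 → ℝ)

theorem slice_degrade_mergeChannel_left (h : z₀ ≠ z₁) :
    slice (degrade p (mergeChannel z₀ z₁ δ)) z₀ = slice p z₀ + δ • slice p z₁ := by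
  rw [slice_degrade, Fintype.sum_eq_add z₀ z₁ h]
  · simp [mergeChannel, h]
  · intro z hz
    simp [mergeChannel, hz.2, hz.1.symm]

theorem slice_degrade_mergeChannel_right (h : z₀ ≠ z₁) :
    slice (degrade p (mergeChannel z₀ z₁ δ)) z₁ = (1 - δ) • slice p z₁ := by
  rw [slice_degrade, Fintype.sum_eq_single z₁]
  · simp [mergeChannel, h.symm]
  · intro z hz
    simp [mergeChannel, hz, hz.symm]

theorem slice_degrade_mergeChannel_of_ne {z : 𝒵} (h₀ : z ≠ z₀) (h₁ : z ≠ z₁) :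
    slice (degrade p (mergeChannel z₀ z₁ δ)) z = slice p z := by
  rw [slice_degrade, Fintype.sum_eq_single z]
  · simp [mergeChannel, h₁]
  · intro z' hz'
    rcases eq_or_ne z' z₁ with rfl | h
    · simp [mergeChannel, h₀, h₁]
    · simp [mergeChannel, h, hz'.symm]

end MergeChannel

section InformationDrop

variable {𝒳 𝒴 𝒵 : Type*} [Fintype 𝒳] [Fintype 𝒴] {p : 𝒳 × 𝒴 × 𝒵 → ℝ} {z₀ z₁ : 𝒵}

theorem exists_condMutualInfo_degrade_lt [Fintype 𝒵] (hp : ∀ a, 0 ≤ p a)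
    (h : freshMass (slice p z₁) (slice p z₀) < recombinedMass (slice p z₁) (slice p z₀)) :
    ∃ W : 𝒵 → 𝒵 → ℝ, (∀ z, W z ∈ stdSimplex ℝ 𝒵) ∧
      condMutualInfo (degrade p W) < condMutualInfo p := by
  classical
  have hslice : ∀ z a, 0 ≤ slice p z a := fun _ _ => hp _
  have hne : z₀ ≠ z₁ := fun he =>
    ne_of_freshMass_lt_recombinedMass (hslice z₁) h (congrArg (slice p) he.symm)
  have hdrop := eventually_weightedMutualInfo_add_smul_lt (hslice z₀)
    (sum_pos_of_freshMass_lt_recombinedMass (hslice z₁) (hslice z₀) h) h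
    (weightedMutualInfo (slice p z₁))
  obtain ⟨δ, hlt, hδ₀, hδ₁⟩ := (hdrop.and (Ioo_mem_nhdsGT one_pos)).exists
  have hW := mergeChannel_mem_stdSimplex z₀ z₁ hδ₀.le hδ₁.le
  refine ⟨mergeChannel z₀ z₁ δ, hW, sub_neg.1 ?_⟩
  rw [condMutualInfo_eq_sum_weightedMutualInfo hp,
    condMutualInfo_eq_sum_weightedMutualInfo (degrade_nonneg hp fun z => (hW z).1),
    ← Finset.sum_sub_distrib, Fintype.sum_eq_add z₀ z₁ hne
      fun z hz => by rw [slice_degrade_mergeChannel_of_ne p hz.1 hz.2, sub_self],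
    slice_degrade_mergeChannel_left p hne, slice_degrade_mergeChannel_right p hne,
    weightedMutualInfo_smul]
  linarith

end InformationDrop

section Guessing

variable {𝒦 : Type*} [Fintype 𝒦]

/-- A guess at an output with nonnegative likelihoods `E`: the normalized likelihoods, averaged
with the uniform distribution so that every value is guessed with probability at least
`1 / (2 |𝒦|)`. -/
noncomputable def guess (E : 𝒦 → ℝ) (k : 𝒦) : ℝ :=
  (E k / ∑ u, E u + (Fintype.card 𝒦 : ℝ)⁻¹) / 2

/-- The likelihood ratio that rewards two parties for the outputs `u` and `v`: agreement pays the
inverse of the probability `Q u` with which an observer guesses the common value. -/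
noncomputable def agreementScore [DecidableEq 𝒦] (Q : 𝒦 → ℝ) (u v : 𝒦) : ℝ :=
  if u = v then (Q u)⁻¹ else 1

variable {E : 𝒦 → ℝ}

theorem inv_two_mul_card_le_guess (hE : ∀ u, 0 ≤ E u) (k : 𝒦) :
    (2 * Fintype.card 𝒦 : ℝ)⁻¹ ≤ guess E k := by
  have hfrac : 0 ≤ E k / ∑ u, E u := div_nonneg (hE k) (Finset.sum_nonneg fun u _ => hE u)
  rw [guess, mul_inv]
  linarith

theorem guess_pos (hE : ∀ u, 0 ≤ E u) (k : 𝒦) : 0 < guess E k := by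
  have : Nonempty 𝒦 := ⟨k⟩
  exact (by positivity : (0 : ℝ) < (2 * Fintype.card 𝒦 : ℝ)⁻¹).trans_le
    (inv_two_mul_card_le_guess hE k)

theorem sum_guess_le_one (E : 𝒦 → ℝ) : ∑ k, guess E k ≤ 1 := by
  have hfrac : (∑ u, E u) / ∑ u, E u ≤ 1 := div_self_le_one _
  have hunif : (Fintype.card 𝒦 : ℝ) * (Fintype.card 𝒦 : ℝ)⁻¹ ≤ 1 := mul_inv_le_one
  simp only [guess, ← Finset.sum_div, Finset.sum_add_distrib, Finset.sum_const, Finset.card_univ,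
    nsmul_eq_mul]
  linarith

theorem mul_inv_guess_le (hE : ∀ u, 0 ≤ E u) (u : 𝒦) :
    E u * (guess E u)⁻¹ ≤ 2 * ∑ v, E v := by
  have hle : E u ≤ ∑ v, E v := Finset.single_le_sum (fun v _ => hE v) (Finset.mem_univ u)
  rw [← div_eq_mul_inv, div_le_iff₀ (guess_pos hE u)]
  rcases (Finset.sum_nonneg fun v _ => hE v : 0 ≤ ∑ v, E v).eq_or_lt with h | h
  · rw [← h] at hle ⊢
    simpa using hle
  · have hcard : 0 ≤ (∑ v, E v) * (Fintype.card 𝒦 : ℝ)⁻¹ := by positivity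
    rw [guess]
    linarith [mul_div_cancel₀ (E u) h.ne']

theorem one_le_agreementScore_guess [DecidableEq 𝒦] (hE : ∀ u, 0 ≤ E u) (u v : 𝒦) :
    1 ≤ agreementScore (guess E) u v := by
  have hle : guess E u ≤ 1 := (Finset.single_le_sum (fun k _ => (guess_pos hE k).le)
    (Finset.mem_univ u)).trans (sum_guess_le_one E)
  rw [agreementScore]
  split_ifs
  · exact (one_le_inv₀ (guess_pos hE u)).2 hle
  · exact le_rfl

theorem neg_logb_guess_le (hE : ∀ u, 0 ≤ E u) (k : 𝒦) :
    -Real.logb 2 (guess E k) ≤ Real.logb 2 (2 * Fintype.card 𝒦) := by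
  have : Nonempty 𝒦 := ⟨k⟩
  rw [← Real.logb_inv]
  exact Real.logb_le_logb_of_le one_lt_two (inv_pos.2 (guess_pos hE k))
    (inv_le_of_inv_le₀ (by positivity) (inv_two_mul_card_le_guess hE k))

theorem neg_logb_guess_le_logb_agreementScore_add [DecidableEq 𝒦] (hE : ∀ u, 0 ≤ E u)
    (k u v : 𝒦) :
    -Real.logb 2 (guess E k) ≤ Real.logb 2 (agreementScore (guess E) u v) +
      if u = k ∧ v = k then 0 else Real.logb 2 (2 * Fintype.card 𝒦) := by
  split_ifs with h
  · rw [h.1, h.2, agreementScore, if_pos rfl, Real.logb_inv, add_zero]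
  · have hscore := Real.logb_nonneg one_lt_two (one_le_agreementScore_guess hE u v)
    linarith [neg_logb_guess_le hE k]

theorem sum_sum_mul_agreementScore_le [DecidableEq 𝒦] {F : 𝒦 → ℝ} (hE : ∀ u, 0 ≤ E u)
    (hF : ∀ v, 0 ≤ F v) :
    ∑ u, ∑ v, E u * F v * agreementScore (guess E) u v ≤ 3 * ((∑ u, E u) * ∑ v, F v) := by
  have split : ∀ u v, E u * F v * agreementScore (guess E) u v ≤
      E u * F v + if u = v then E u * (guess E u)⁻¹ * F v else 0 := by
    intro u v
    have hprod := mul_nonneg (hE u) (hF v)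
    rw [agreementScore]
    split_ifs <;> linarith
  have diagonal : ∑ u, E u * (guess E u)⁻¹ * F u ≤ 2 * (∑ v, E v) * ∑ u, F u := by
    rw [Finset.mul_sum]
    exact Finset.sum_le_sum fun u _ => mul_le_mul_of_nonneg_right (mul_inv_guess_le hE u) (hF u)
  refine (Finset.sum_le_sum fun u _ => Finset.sum_le_sum fun v _ => split u v).trans ?_
  simp only [Finset.sum_add_distrib, Finset.sum_ite_eq, Finset.mem_univ, if_true,
    ← Finset.sum_mul_sum]
  linarith

end Guessing

section Discussion

variable {A B D M 𝒦 : Type*} [Fintype M] [Fintype 𝒦]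

/-- The transition probabilities of a public discussion with transcript in `M` and outputs in `𝒦`:
from inputs `a` and `b` it produces the transcript `m` and the outputs `u`, `v` with probability
`α a m u * β b m v`. -/
structure IsDiscussion (α : A → M → 𝒦 → ℝ) (β : B → M → 𝒦 → ℝ) : Prop where
  nonneg_left : ∀ a m u, 0 ≤ α a m u
  nonneg_right : ∀ b m v, 0 ≤ β b m v
  sum_eq_one : ∀ a b, ∑ t : M × 𝒦 × 𝒦, α a t.1 t.2.1 * β b t.1 t.2.2 = 1

theorem IsDiscussion.mem_stdSimplex {α : A → M → 𝒦 → ℝ} {β : B → M → 𝒦 → ℝ}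
    (h : IsDiscussion α β) (a : A) (b : B) :
    (fun t : M × 𝒦 × 𝒦 => α a t.1 t.2.1 * β b t.1 t.2.2) ∈ stdSimplex ℝ (M × 𝒦 × 𝒦) :=
  ⟨fun _ => mul_nonneg (h.nonneg_left _ _ _) (h.nonneg_right _ _ _), h.sum_eq_one a b⟩

variable [Fintype A] [Fintype B]

/-- The likelihood of the transcript `m` and the first output `u` for an observer of `d`, as far as
the first party's factor `α` of the discussion is concerned: the mean of `α a m u` under the
conditional distribution of `a` given `d`. -/
noncomputable def outputLikelihood (r : A × B × D → ℝ) (α : A → M → 𝒦 → ℝ) (d : D) (m : M)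
    (u : 𝒦) : ℝ :=
  ∑ a, margFst (slice r d) a / margZ r d * α a m u

theorem IsDiscussion.outputLikelihood_nonneg {r : A × B × D → ℝ} {α : A → M → 𝒦 → ℝ}
    {β : B → M → 𝒦 → ℝ} (h : IsDiscussion α β) (hr : ∀ a, 0 ≤ r a) (d : D) (m : M) (u : 𝒦) :
    0 ≤ outputLikelihood r α d m u :=
  Finset.sum_nonneg fun a _ => mul_nonneg
    (div_nonneg (margFst_nonneg (fun _ => hr _) a) (margZ_nonneg hr d)) (h.nonneg_left a m u)

variable [Fintype D]

theorem sum_sum_discussion (γ : A → D → ℝ) (η : B → D → ℝ) (α : A → M → 𝒦 → ℝ)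
    (β : B → M → 𝒦 → ℝ) (w : D → M → 𝒦 → 𝒦 → ℝ) :
    ∑ s : A × B × D, γ s.1 s.2.2 * η s.2.1 s.2.2 *
        ∑ t : M × 𝒦 × 𝒦, α s.1 t.1 t.2.1 * β s.2.1 t.1 t.2.2 * w s.2.2 t.1 t.2.1 t.2.2 =
      ∑ d, ∑ m, ∑ u, ∑ v,
        (∑ a, γ a d * α a m u) * (∑ b, η b d * β b m v) * w d m u v := by
  let regroup : (A × B × D) × M × 𝒦 × 𝒦 ≃ (D × M × 𝒦 × 𝒦) × A × B :=
    { toFun := fun i => ((i.1.2.2, i.2), (i.1.1, i.1.2.1))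
      invFun := fun j => ((j.2.1, j.2.2, j.1.1), j.1.2) }
  calc
    _ = ∑ i : (A × B × D) × M × 𝒦 × 𝒦, γ i.1.1 i.1.2.2 * η i.1.2.1 i.1.2.2 *
          (α i.1.1 i.2.1 i.2.2.1 * β i.1.2.1 i.2.1 i.2.2.2 *
            w i.1.2.2 i.2.1 i.2.2.1 i.2.2.2) := by
      simp only [Finset.mul_sum, Fintype.sum_prod_type]
    _ = ∑ j : (D × M × 𝒦 × 𝒦) × A × B,
          γ j.2.1 j.1.1 * α j.2.1 j.1.2.1 j.1.2.2.1 *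
            (η j.2.2 j.1.1 * β j.2.2 j.1.2.1 j.1.2.2.2) *
            w j.1.1 j.1.2.1 j.1.2.2.1 j.1.2.2.2 :=
      Fintype.sum_equiv regroup _ _ fun _ => by
        simp only [regroup, Equiv.coe_fn_mk]
        ring
    _ = _ := by
      simp only [Finset.sum_mul_sum]
      simp only [Finset.sum_mul, Fintype.sum_prod_type]

theorem IsDiscussion.sum_mul_agreementScore_le [DecidableEq 𝒦] {γ : A → D → ℝ} {η : B → D → ℝ}
    {α : A → M → 𝒦 → ℝ} {β : B → M → 𝒦 → ℝ} (h : IsDiscussion α β) (hγ : ∀ a d, 0 ≤ γ a d)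
    (hη : ∀ b d, 0 ≤ η b d) :
    ∑ s : A × B × D, γ s.1 s.2.2 * η s.2.1 s.2.2 *
        ∑ t : M × 𝒦 × 𝒦, α s.1 t.1 t.2.1 * β s.2.1 t.1 t.2.2 *
          agreementScore (guess fun u => ∑ a, γ a s.2.2 * α a t.1 u) t.2.1 t.2.2 ≤
      3 * ∑ s : A × B × D, γ s.1 s.2.2 * η s.2.1 s.2.2 := by
  have hE : ∀ d m u, 0 ≤ ∑ a, γ a d * α a m u := fun d m u =>
    Finset.sum_nonneg fun a _ => mul_nonneg (hγ a d) (h.nonneg_left a m u)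
  have hF : ∀ d m v, 0 ≤ ∑ b, η b d * β b m v := fun d m v =>
    Finset.sum_nonneg fun b _ => mul_nonneg (hη b d) (h.nonneg_right b m v)
  have htotal := sum_sum_discussion γ η α β fun _ _ _ _ => 1
  simp only [mul_one, h.sum_eq_one, ← Finset.sum_mul_sum] at htotal
  rw [sum_sum_discussion γ η α β fun d m u v =>
    agreementScore (guess fun u => ∑ a, γ a d * α a m u) u v, htotal]
  simp only [Finset.mul_sum (s := Finset.univ (α := D)), Finset.mul_sum (s := Finset.univ (α := M))]
  exact Finset.sum_le_sum fun d _ => Finset.sum_le_sum fun m _ =>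
    sum_sum_mul_agreementScore_le (hE d m) (hF d m)

theorem IsDiscussion.sum_mul_logb_agreementScore_le [DecidableEq 𝒦] {r : A × B × D → ℝ}
    {α : A → M → 𝒦 → ℝ} {β : B → M → 𝒦 → ℝ} (h : IsDiscussion α β)
    (hr : r ∈ stdSimplex ℝ (A × B × D)) :
    ∑ s, r s * ∑ t : M × 𝒦 × 𝒦, α s.1 t.1 t.2.1 * β s.2.1 t.1 t.2.2 *
        Real.logb 2 (agreementScore (guess (outputLikelihood r α s.2.2 t.1)) t.2.1 t.2.2) ≤
      condMutualInfo r + Real.logb 2 3 := by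
  have hscore : ∑ s, condIndep r s * ∑ t : M × 𝒦 × 𝒦, α s.1 t.1 t.2.1 * β s.2.1 t.1 t.2.2 *
      agreementScore (guess (outputLikelihood r α s.2.2 t.1)) t.2.1 t.2.2 ≤ 3 := by
    refine (h.sum_mul_agreementScore_le (γ := fun a d => margFst (slice r d) a / margZ r d)
      (η := fun b d => margSnd (slice r d) b)
      (fun a d => div_nonneg (margFst_nonneg (fun _ => hr.1 _) a) (margZ_nonneg hr.1 d))
      (fun b d => margSnd_nonneg (fun _ => hr.1 _) b)).trans_eq ?_
    have htotal : ∑ s, condIndep r s = 1 := (sum_condIndep r).trans hr.2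
    simp only [condIndep] at htotal
    rw [htotal, mul_one]
  rw [condMutualInfo_eq_relEntropy hr.1]
  have hscore_pos : ∀ (s : A × B × D) (t : M × 𝒦 × 𝒦),
      0 < agreementScore (guess (outputLikelihood r α s.2.2 t.1)) t.2.1 t.2.2 := fun s t =>
    zero_lt_one.trans_le
      (one_le_agreementScore_guess (h.outputLikelihood_nonneg hr.1 _ _) _ _)
  exact sum_mul_sum_logb_le_relEntropy_add hr (condIndep_nonneg hr.1)
    (fun s => condIndep_pos hr.1) (fun s => h.mem_stdSimplex s.1 s.2.1) hscore_pos three_pos hscore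

end Discussion

section Law

variable {Ω S : Type*} [MeasurableSpace Ω] {μ : Measure Ω} {U : Ω → S}

/-- `U` is a discrete random variable: the events `U = s` are measurable. It replaces `Measurable`
for variables whose range carries no `MeasurableSpace` instance. -/
def MeasurableFibers (U : Ω → S) : Prop :=
  ∀ s, MeasurableSet {ω | U ω = s}

theorem law_nonneg (μ : Measure Ω) (U : Ω → S) (s : S) : 0 ≤ law μ U s :=
  measureReal_nonneg

theorem MeasurableFibers.measurable [Countable S] (hU : MeasurableFibers U) :
    Measurable[_, ⊤] U :=
  let _ : MeasurableSpace S := ⊤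
  measurable_to_countable' hU

theorem MeasurableFibers.comp [Countable S] (hU : MeasurableFibers U) {T : Type*} (φ : S → T) :
    MeasurableFibers fun ω => φ (U ω) := fun t =>
  hU.measurable (t := {s | φ s = t}) trivial

theorem MeasurableFibers.prodMk {T : Type*} {V : Ω → T} (hU : MeasurableFibers U)
    (hV : MeasurableFibers V) : MeasurableFibers fun ω => (U ω, V ω) := by
  rintro ⟨s, t⟩
  simp only [Prod.mk.injEq]
  exact (hU s).inter (hV t)

theorem MeasurableFibers.integrable_comp [IsFiniteMeasure μ] [Finite S] (hU : MeasurableFibers U)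
    (F : S → ℝ) : Integrable (fun ω => F (U ω)) μ := by
  let _ : MeasurableSpace S := ⊤
  exact (Integrable.of_finite (μ := μ.map U)).comp_measurable hU.measurable

theorem MeasurableFibers.sum_law_mul [IsFiniteMeasure μ] [Fintype S] (hU : MeasurableFibers U)
    (F : S → ℝ) : ∑ s, law μ U s * F s = ∫ ω, F (U ω) ∂μ := by
  let _ : MeasurableSpace S := ⊤
  rw [← integral_map (f := F) hU.measurable.aemeasurable (by fun_prop), integral_fintype
    (.of_finite)]
  refine Finset.sum_congr rfl fun s _ => ?_
  rw [map_measureReal_apply hU.measurable (MeasurableSet.singleton s), smul_eq_mul]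
  rfl

theorem MeasurableFibers.sum_law [IsProbabilityMeasure μ] [Fintype S] (hU : MeasurableFibers U) :
    ∑ s, law μ U s = 1 := by
  simpa using hU.sum_law_mul (μ := μ) fun _ => 1

end Law

section OneShot

variable {Ω 𝒦 M : Type*} [MeasurableSpace Ω] {μ : Measure Ω} [IsProbabilityMeasure μ]
  [Fintype 𝒦] [Fintype M]

theorem condEntropy_law_le_integral_logb_agreementScore [DecidableEq 𝒦] {C D : Type*} [Fintype C]
    [Fintype D] {K U U' : Ω → 𝒦} {Z : Ω → C} {V : Ω → M}
    (hmeas : MeasurableFibers fun ω => (K ω, Z ω, V ω, U ω, U' ω)) {W : C → D → ℝ}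
    (hW : ∀ c, W c ∈ stdSimplex ℝ D) {E : D → M → 𝒦 → ℝ} (hE : ∀ d m u, 0 ≤ E d m u) :
    condEntropy (law μ fun ω => (K ω, (Z ω, V ω))) ≤
      ∫ ω, ∑ d, W (Z ω) d *
          Real.logb 2 (agreementScore (guess (E d (V ω))) (U ω) (U' ω)) ∂μ +
        (1 - μ.real {ω | U ω = K ω ∧ U' ω = K ω}) * Real.logb 2 (2 * Fintype.card 𝒦) := by
  let score (s : 𝒦 × C × M × 𝒦 × 𝒦) : ℝ :=
    ∑ d, W s.2.1 d * Real.logb 2 (agreementScore (guess (E d s.2.2.1)) s.2.2.2.1 s.2.2.2.2)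
  let penalty (s : 𝒦 × C × M × 𝒦 × 𝒦) : ℝ :=
    if s.2.2.2.1 = s.1 ∧ s.2.2.2.2 = s.1 then 0 else Real.logb 2 (2 * Fintype.card 𝒦)
  let surprise (s : 𝒦 × C × M) : ℝ := ∑ d, W s.2.1 d * -Real.logb 2 (guess (E d s.2.2) s.1)
  set R : Ω → 𝒦 × C × M × 𝒦 × 𝒦 := fun ω => (K ω, Z ω, V ω, U ω, U' ω)
  have hKZV : MeasurableFibers fun ω => (K ω, (Z ω, V ω)) :=
    hmeas.comp fun s => (s.1, (s.2.1, s.2.2.1))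
  have hbad : ∫ ω, penalty (R ω) ∂μ =
      (1 - μ.real {ω | U ω = K ω ∧ U' ω = K ω}) * Real.logb 2 (2 * Fintype.card 𝒦) := by
    have hgood : MeasurableSet {ω | U ω = K ω ∧ U' ω = K ω} :=
      hmeas.measurable (t := {s | s.2.2.2.1 = s.1 ∧ s.2.2.2.2 = s.1}) trivial
    have hind : (fun ω => penalty (R ω)) = {ω | U ω = K ω ∧ U' ω = K ω}ᶜ.indicator
        fun _ => Real.logb 2 (2 * Fintype.card 𝒦) := by
      ext ω
      by_cases h : U ω = K ω ∧ U' ω = K ω <;> simp [penalty, R, h]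
    rw [hind, integral_indicator_const _ hgood.compl, probReal_compl_eq_one_sub hgood, smul_eq_mul]
  calc
    _ ≤ ∑ s, law μ (fun ω => (K ω, (Z ω, V ω))) s * surprise s :=
      condEntropy_le_sum_mul_neg_logb (r := law μ fun ω => (K ω, (Z ω, V ω)))
        (W := fun b : C × M => W b.1) (G := fun b d => guess (E d b.2)) (law_nonneg μ _)
        (fun b => hW b.1) (fun b d => guess_pos (hE d b.2)) fun b d => sum_guess_le_one (E d b.2)
    _ = ∫ ω, surprise (K ω, (Z ω, V ω)) ∂μ := hKZV.sum_law_mul surprise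
    _ ≤ ∫ ω, score (R ω) + penalty (R ω) ∂μ := by
      refine integral_mono (hKZV.integrable_comp surprise)
        ((hmeas.integrable_comp score).add (hmeas.integrable_comp penalty)) fun ω => ?_
      rw [← one_mul (penalty (R ω)), ← (hW (Z ω)).2, Finset.sum_mul, ← Finset.sum_add_distrib]
      refine Finset.sum_le_sum fun d _ => ?_
      rw [← mul_add]
      exact mul_le_mul_of_nonneg_left
        (neg_logb_guess_le_logb_agreementScore_add (hE d (V ω)) _ _ _) ((hW _).1 d)
    _ = _ := by
      rw [integral_add (hmeas.integrable_comp score) (hmeas.integrable_comp penalty), hbad]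

variable {𝒳 𝒴 𝒵 𝒥 : Type*} [Fintype 𝒳] [Fintype 𝒴] [Fintype 𝒵] [Fintype 𝒥]

theorem IsDiscussion.condEntropy_law_le {p : 𝒳 × 𝒴 × 𝒵 → ℝ}
    {α : 𝒳 → M → 𝒦 → ℝ} {β : 𝒴 → M → 𝒦 → ℝ} (h : IsDiscussion α β) {S : Ω → 𝒳 × 𝒴 × 𝒵}
    {T : Ω → M × 𝒦 × 𝒦} {K : Ω → 𝒦} (hp : p ∈ stdSimplex ℝ (𝒳 × 𝒴 × 𝒵))
    (hK : MeasurableFibers K) (hST : MeasurableFibers fun ω => (S ω, T ω))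
    (hlaw : ∀ a t, law μ (fun ω => (S ω, T ω)) (a, t) =
      p a * (α a.1 t.1 t.2.1 * β a.2.1 t.1 t.2.2))
    {W : 𝒵 → 𝒥 → ℝ} (hW : ∀ z, W z ∈ stdSimplex ℝ 𝒥) :
    condEntropy (law μ fun ω => (K ω, ((S ω).2.2, (T ω).1))) ≤
      condMutualInfo (degrade p W) + Real.logb 2 3 +
        (1 - μ.real {ω | (T ω).2.1 = K ω ∧ (T ω).2.2 = K ω}) *
          Real.logb 2 (2 * Fintype.card 𝒦) := by
  classical
  set r := degrade p W
  have hr : r ∈ stdSimplex ℝ (𝒳 × 𝒴 × 𝒥) := degrade_mem_stdSimplex hp hW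
  let score (d : 𝒥) (t : M × 𝒦 × 𝒦) : ℝ :=
    Real.logb 2 (agreementScore (guess (outputLikelihood r α d t.1)) t.2.1 t.2.2)
  have hintegral : ∫ ω, ∑ d, W (S ω).2.2 d * score d (T ω) ∂μ =
      ∑ s, r s * ∑ t : M × 𝒦 × 𝒦, α s.1 t.1 t.2.1 * β s.2.1 t.1 t.2.2 * score s.2.2 t := by
    rw [← hST.sum_law_mul fun s => ∑ d, W s.1.2.2 d * score d s.2, sum_degrade_mul]
    simp only [Fintype.sum_prod_type (α₁ := 𝒳 × 𝒴 × 𝒵), hlaw]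
    refine Finset.sum_congr rfl fun a _ => ?_
    simp only [Finset.mul_sum]
    rw [Finset.sum_comm]
    exact Finset.sum_congr rfl fun d _ => Finset.sum_congr rfl fun t _ => by ring
  have hentropy := condEntropy_law_le_integral_logb_agreementScore (μ := μ)
    ((hK.prodMk hST).comp fun s => (s.1, s.2.1.2.2, s.2.2)) hW
    (fun d m u => h.outputLikelihood_nonneg hr.1 d m u)
  refine hentropy.trans (add_le_add_left (hintegral.trans_le ?_) _)
  exact h.sum_mul_logb_agreementScore_le hr

end OneShot

section Copies

variable {𝒳 𝒴 𝒵 : Type*} {p : 𝒳 × 𝒴 × 𝒵 → ℝ} {ι : Type*} [Fintype ι]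

/-- The joint distribution of independent copies, indexed by `ι`, of a source `(X, Y, Z)`. -/
def iidSource (ι : Type*) [Fintype ι] (p : 𝒳 × 𝒴 × 𝒵 → ℝ)
    (a : (ι → 𝒳) × (ι → 𝒴) × (ι → 𝒵)) : ℝ :=
  ∏ i, p (a.1 i, a.2.1 i, a.2.2 i)

/-- The memoryless channel whose uses, indexed by `ι`, are copies of the channel `W`. -/
def iidChannel (ι : Type*) [Fintype ι] {𝒥 : Type*} (W : 𝒵 → 𝒥 → ℝ) (z : ι → 𝒵) (j : ι → 𝒥) :
    ℝ :=
  ∏ i, W (z i) (j i)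

/-- Three sequences as one sequence of triples. -/
def zipTriple (ι 𝒳 𝒴 𝒵 : Type*) : (ι → 𝒳) × (ι → 𝒴) × (ι → 𝒵) ≃ (ι → 𝒳 × 𝒴 × 𝒵) where
  toFun a i := (a.1 i, a.2.1 i, a.2.2 i)
  invFun s := (fun i => (s i).1, fun i => (s i).2.1, fun i => (s i).2.2)

variable [DecidableEq ι]

theorem prod_mem_stdSimplex {S : Type*} [Fintype S] {q : ι → S → ℝ}
    (hq : ∀ i, q i ∈ stdSimplex ℝ S) : (fun s : ι → S => ∏ i, q i (s i)) ∈ stdSimplex ℝ (ι → S) :=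
  ⟨fun _ => Finset.prod_nonneg fun i _ => (hq i).1 _, by
    rw [← Fintype.prod_sum]
    exact Finset.prod_eq_one fun i _ => (hq i).2⟩

theorem iidChannel_mem_stdSimplex {𝒥 : Type*} [Fintype 𝒥] {W : 𝒵 → 𝒥 → ℝ}
    (hW : ∀ z, W z ∈ stdSimplex ℝ 𝒥) (z : ι → 𝒵) :
    iidChannel ι W z ∈ stdSimplex ℝ (ι → 𝒥) :=
  prod_mem_stdSimplex fun i => hW (z i)

theorem condIndep_iidSource [Fintype 𝒳] [Fintype 𝒴] (p : 𝒳 × 𝒴 × 𝒵 → ℝ) :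
    condIndep (iidSource ι p) = iidSource ι (condIndep p) := by
  ext a
  simp only [condIndep, iidSource, margFst, margSnd, margZ, slice, Finset.prod_mul_distrib,
    Finset.prod_div_distrib, Fintype.prod_sum]

variable [Fintype 𝒵]

theorem degrade_iidSource_iidChannel {𝒥 : Type*} (p : 𝒳 × 𝒴 × 𝒵 → ℝ) (W : 𝒵 → 𝒥 → ℝ) :
    degrade (iidSource ι p) (iidChannel ι W) = iidSource ι (degrade p W) := by
  ext a
  simp only [degrade, iidSource, iidChannel, Fintype.prod_sum, Finset.prod_mul_distrib]

variable [Fintype 𝒳] [Fintype 𝒴]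

theorem iidSource_mem_stdSimplex (hp : p ∈ stdSimplex ℝ (𝒳 × 𝒴 × 𝒵)) :
    iidSource ι p ∈ stdSimplex ℝ ((ι → 𝒳) × (ι → 𝒴) × (ι → 𝒵)) :=
  ⟨fun _ => Finset.prod_nonneg fun _ _ => hp.1 _,
    ((zipTriple ι 𝒳 𝒴 𝒵).sum_comp fun s => ∏ i, p (s i)).trans
      (prod_mem_stdSimplex fun _ => hp).2⟩

theorem condMutualInfo_iidSource (hp : p ∈ stdSimplex ℝ (𝒳 × 𝒴 × 𝒵)) :
    condMutualInfo (iidSource ι p) = Fintype.card ι * condMutualInfo p := by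
  rw [condMutualInfo_eq_relEntropy (iidSource_mem_stdSimplex hp).1, condIndep_iidSource,
    condMutualInfo_eq_relEntropy hp.1, ← relEntropy_pi hp fun _ => condIndep_pos hp.1,
    ← relEntropy_comp_equiv (zipTriple ι 𝒳 𝒴 𝒵)]
  rfl

end Copies

section Protocol

theorem existsUnique_forall_eq_prefix {α : Type*} {r : ℕ} (F : ∀ i : Fin r, (Fin i → α) → α) :
    ∃! m : Fin r → α, ∀ i, m i = F i fun j => m (j.castLE i.isLt.le) := by
  refine ⟨WellFoundedLT.fix fun i past => F i fun j => past (j.castLE i.isLt.le) j.isLt,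
    WellFoundedLT.fix_eq _, fun m hm => funext fun i => ?_⟩
  induction i using WellFoundedLT.induction with
  | ind i ih =>
    rw [hm, WellFoundedLT.fix_eq]
    exact congrArg (F i) (funext fun j => ih _ j.isLt)

namespace KeyProtocol

variable {𝒳 𝒴 𝒵 : Type*} {p : 𝒳 × 𝒴 × 𝒵 → ℝ} {n : ℕ} (P : KeyProtocol p n)

attribute [local instance] measurableSpaceA measurableSpaceB

/-- The source sequences of Alice, Bob and Eve. -/
def source (ω : P.Ω) : (Fin n → 𝒳) × (Fin n → 𝒴) × (Fin n → 𝒵) := (P.X ω, P.Y ω, P.Z ω)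

/-- The transcript of the discussion together with the outputs of Alice and Bob. -/
def outcome (ω : P.Ω) : (Fin P.rounds → P.Msg) × P.Key × P.Key :=
  (fun i => P.M i ω, P.f ω, P.g ω)

/-- A description of the protocol by rectangles: the transcript and the outputs are `(m, u, v)`
exactly when `Q_A ∈ sA X m u` and `Q_B ∈ sB Y m v`. -/
structure IsRectangular (sA : (Fin n → 𝒳) → (Fin P.rounds → P.Msg) → P.Key → Set P.RangeA)
    (sB : (Fin n → 𝒴) → (Fin P.rounds → P.Msg) → P.Key → Set P.RangeB) : Prop where
  measurableSet_left : ∀ x m u, MeasurableSet (sA x m u)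
  measurableSet_right : ∀ y m v, MeasurableSet (sB y m v)
  existsUnique : ∀ x y qa qb, ∃! t : (Fin P.rounds → P.Msg) × P.Key × P.Key,
    qa ∈ sA x t.1 t.2.1 ∧ qb ∈ sB y t.1 t.2.2
  mem_outcome : ∀ ω, P.QA ω ∈ sA (P.X ω) (P.outcome ω).1 (P.outcome ω).2.1 ∧
    P.QB ω ∈ sB (P.Y ω) (P.outcome ω).1 (P.outcome ω).2.2

theorem exists_round_conditions (i : Fin P.rounds) :
    ∃ (cA : (Fin n → 𝒳) → (Fin P.rounds → P.Msg) → Set P.RangeA)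
      (cB : (Fin n → 𝒴) → (Fin P.rounds → P.Msg) → Set P.RangeB),
      (∀ x m, MeasurableSet (cA x m)) ∧ (∀ y m, MeasurableSet (cB y m)) ∧
      (∀ x y qa qb, ∃ F : (Fin i → P.Msg) → P.Msg, ∀ m,
        qa ∈ cA x m ∧ qb ∈ cB y m ↔ m i = F fun j => m (j.castLE i.isLt.le)) ∧
      ∀ ω, P.QA ω ∈ cA (P.X ω) (P.outcome ω).1 ∧ P.QB ω ∈ cB (P.Y ω) (P.outcome ω).1 := by
  rcases P.isMessage i with ⟨φ, hφ, hM⟩ | ⟨φ, hφ, hM⟩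
  · refine ⟨fun x m => {q | φ x q (fun j => m (j.castLE i.isLt.le)) = m i},
      fun _ _ => Set.univ, fun x m => hφ _ _ _, fun _ _ => .univ, fun x y qa qb =>
      ⟨φ x qa, fun m => ?_⟩, fun ω => ⟨(hM ω).symm, trivial⟩⟩
    exact (and_iff_left trivial).trans eq_comm
  · refine ⟨fun _ _ => Set.univ, fun y m => {q | φ y q (fun j => m (j.castLE i.isLt.le)) = m i},
      fun _ _ => .univ, fun y m => hφ _ _ _, fun x y qa qb =>
      ⟨φ y qb, fun m => ?_⟩, fun ω => ⟨trivial, (hM ω).symm⟩⟩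
    exact (and_iff_right trivial).trans eq_comm

theorem exists_isRectangular : ∃ sA sB, P.IsRectangular sA sB := by
  choose cA cB hcA hcB hround hmem using P.exists_round_conditions
  obtain ⟨φ, hφ, hf⟩ := P.isOutput_f
  obtain ⟨ψ, hψ, hg⟩ := P.isOutput_g
  refine ⟨fun x m u => (⋂ i, cA i x m) ∩ {q | φ x q m = u},
    fun y m v => (⋂ i, cB i y m) ∩ {q | ψ y q m = v},
    fun x m u => (MeasurableSet.iInter fun i => hcA i x m).inter (hφ x m u),
    fun y m v => (MeasurableSet.iInter fun i => hcB i y m).inter (hψ y m v),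
    fun x y qa qb => ?_, fun ω => ⟨⟨Set.mem_iInter.2 fun i => (hmem i ω).1, (hf ω).symm⟩,
      ⟨Set.mem_iInter.2 fun i => (hmem i ω).2, (hg ω).symm⟩⟩⟩
  choose F hF using fun i => hround i x y qa qb
  obtain ⟨m, hm, hm_unique⟩ := existsUnique_forall_eq_prefix F
  have hconsistent : ∀ i, qa ∈ cA i x m ∧ qb ∈ cB i y m := fun i => (hF i m).2 (hm i)
  refine ⟨(m, φ x qa m, ψ y qb m), ⟨⟨Set.mem_iInter.2 fun i => (hconsistent i).1, rfl⟩,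
    ⟨Set.mem_iInter.2 fun i => (hconsistent i).2, rfl⟩⟩, ?_⟩
  rintro ⟨m', u, v⟩ ⟨⟨hA, rfl : φ x qa m' = u⟩, ⟨hB, rfl : ψ y qb m' = v⟩⟩
  obtain rfl := hm_unique m' fun i =>
    (hF i m').1 ⟨Set.mem_iInter.1 hA i, Set.mem_iInter.1 hB i⟩
  rfl

theorem measureReal_source_inter {sA : Set P.RangeA} {sB : Set P.RangeB} (hA : MeasurableSet sA)
    (hB : MeasurableSet sB) (s : Set ((Fin n → 𝒳) × (Fin n → 𝒴) × (Fin n → 𝒵))) :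
    P.μ.real (P.source ⁻¹' s ∩ (P.QA ⁻¹' sA ∩ P.QB ⁻¹' sB)) =
      P.μ.real (P.source ⁻¹' s) * (P.μ.real (P.QA ⁻¹' sA) * P.μ.real (P.QB ⁻¹' sB)) := by
  have hprod := P.indep.meas_iInter (s := ![P.QA ⁻¹' sA, P.QB ⁻¹' sB, P.source ⁻¹' s]) (by
    intro i
    fin_cases i
    exacts [⟨sA, hA, rfl⟩, ⟨sB, hB, rfl⟩, ⟨s, trivial, rfl⟩])
  have hinter : ⋂ i, (![P.QA ⁻¹' sA, P.QB ⁻¹' sB, P.source ⁻¹' s] : Fin 3 → Set P.Ω) i =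
      P.source ⁻¹' s ∩ (P.QA ⁻¹' sA ∩ P.QB ⁻¹' sB) := by
    ext ω
    simp only [Set.mem_iInter, Fin.forall_fin_succ, Set.mem_inter_iff]
    simp
    tauto
  rw [hinter, Fin.prod_univ_three] at hprod
  simp only [measureReal_def, hprod, ENNReal.toReal_mul, Matrix.cons_val]
  ring

variable {P} {sA : (Fin n → 𝒳) → (Fin P.rounds → P.Msg) → P.Key → Set P.RangeA}
  {sB : (Fin n → 𝒴) → (Fin P.rounds → P.Msg) → P.Key → Set P.RangeB}

theorem IsRectangular.source_outcome_fiber (h : P.IsRectangular sA sB)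
    (a : (Fin n → 𝒳) × (Fin n → 𝒴) × (Fin n → 𝒵))
    (t : (Fin P.rounds → P.Msg) × P.Key × P.Key) :
    {ω | (P.source ω, P.outcome ω) = (a, t)} =
      P.source ⁻¹' {a} ∩ (P.QA ⁻¹' sA a.1 t.1 t.2.1 ∩ P.QB ⁻¹' sB a.2.1 t.1 t.2.2) := by
  ext ω
  simp only [Set.mem_ofPred_eq, Prod.mk.injEq, Set.mem_inter_iff, Set.mem_preimage,
    Set.mem_singleton_iff]
  refine and_congr_right ?_
  rintro rfl
  exact ⟨fun ht => ht ▸ h.mem_outcome ω, (h.existsUnique _ _ _ _).unique (h.mem_outcome ω)⟩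

theorem IsRectangular.measurableFibers (h : P.IsRectangular sA sB) :
    MeasurableFibers fun ω => (P.source ω, P.outcome ω) := by
  rintro ⟨a, t⟩
  rw [h.source_outcome_fiber]
  exact (P.measurable_source a.1 a.2.1 a.2.2).inter
    ((P.measurable_QA (h.measurableSet_left _ _ _)).inter
      (P.measurable_QB (h.measurableSet_right _ _ _)))

theorem IsRectangular.law_source_outcome (h : P.IsRectangular sA sB)
    (a : (Fin n → 𝒳) × (Fin n → 𝒴) × (Fin n → 𝒵))
    (t : (Fin P.rounds → P.Msg) × P.Key × P.Key) :
    law P.μ (fun ω => (P.source ω, P.outcome ω)) (a, t) = iidSource (Fin n) p a *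
      (P.μ.real (P.QA ⁻¹' sA a.1 t.1 t.2.1) * P.μ.real (P.QB ⁻¹' sB a.2.1 t.1 t.2.2)) := by
  rw [law, h.source_outcome_fiber, P.measureReal_source_inter (h.measurableSet_left _ _ _)
    (h.measurableSet_right _ _ _)]
  exact congrArg (· * _) (P.law_source a.1 a.2.1 a.2.2)

theorem IsRectangular.isDiscussion (h : P.IsRectangular sA sB) :
    IsDiscussion (fun x m u => P.μ.real (P.QA ⁻¹' sA x m u))
      (fun y m v => P.μ.real (P.QB ⁻¹' sB y m v)) where
  nonneg_left _ _ _ := measureReal_nonneg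
  nonneg_right _ _ _ := measureReal_nonneg
  sum_eq_one x y := by
    choose τ hτ hτ_unique using fun ω => h.existsUnique x y (P.QA ω) (P.QB ω)
    have hfiber : ∀ t, {ω | τ ω = t} = P.QA ⁻¹' sA x t.1 t.2.1 ∩ P.QB ⁻¹' sB y t.1 t.2.2 := by
      intro t
      ext ω
      exact ⟨fun ht => ht ▸ hτ ω, fun ht => (hτ_unique ω t ht).symm⟩
    have hmeas : MeasurableFibers τ := by
      intro t
      rw [hfiber]
      exact (P.measurable_QA (h.measurableSet_left _ _ _)).inter
        (P.measurable_QB (h.measurableSet_right _ _ _))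
    rw [← hmeas.sum_law (μ := P.μ)]
    refine Finset.sum_congr rfl fun t _ => ?_
    have hindep := P.measureReal_source_inter (h.measurableSet_left x t.1 t.2.1)
      (h.measurableSet_right y t.1 t.2.2) Set.univ
    simpa [law, hfiber] using hindep.symm

variable [Fintype 𝒳] [Fintype 𝒴] [Fintype 𝒵] {𝒥 : Type*} [Fintype 𝒥] {W : 𝒵 → 𝒥 → ℝ} (P)

theorem eveEntropy_le (hp : p ∈ stdSimplex ℝ (𝒳 × 𝒴 × 𝒵)) (hW : ∀ z, W z ∈ stdSimplex ℝ 𝒥) :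
    P.eveEntropy ≤ n * condMutualInfo (degrade p W) + Real.logb 2 3 +
      (1 - P.μ.real {ω | P.f ω = P.K ω ∧ P.g ω = P.K ω}) *
        Real.logb 2 (2 * Fintype.card P.Key) := by
  obtain ⟨sA, sB, h⟩ := P.exists_isRectangular
  have hbound := h.isDiscussion.condEntropy_law_le (iidSource_mem_stdSimplex hp) P.measurable_K
    h.measurableFibers h.law_source_outcome (iidChannel_mem_stdSimplex hW)
  rwa [degrade_iidSource_iidChannel, condMutualInfo_iidSource (degrade_mem_stdSimplex hp hW),
    Fintype.card_fin] at hbound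

theorem one_sub_mul_logb_card_le (hp : p ∈ stdSimplex ℝ (𝒳 × 𝒴 × 𝒵))
    (hW : ∀ z, W z ∈ stdSimplex ℝ 𝒥) {ε : ℝ} (hε : ε ≤ 1)
    (hagree : 1 - ε < P.μ.real {ω | P.f ω = P.K ω ∧ P.g ω = P.K ω})
    (hsecret : Real.logb 2 (Fintype.card P.Key) - P.eveEntropy < ε) :
    (1 - ε) * Real.logb 2 (Fintype.card P.Key) ≤
      n * condMutualInfo (degrade p W) + (Real.logb 2 3 + 2) := by
  have : Nonempty P.Ω := P.μ.nonempty_of_neZero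
  have : Nonempty P.Key := .map P.K this
  have hcard : (1 : ℝ) ≤ Fintype.card P.Key := by exact_mod_cast Fintype.card_pos
  have hlog : Real.logb 2 (2 * Fintype.card P.Key) = 1 + Real.logb 2 (Fintype.card P.Key) := by
    rw [Real.logb_mul two_ne_zero (by positivity), Real.logb_self_eq_one one_lt_two]
  have hentropy := P.eveEntropy_le hp hW
  rw [hlog] at hentropy
  have herror : (1 - P.μ.real {ω | P.f ω = P.K ω ∧ P.g ω = P.K ω}) *
      (1 + Real.logb 2 (Fintype.card P.Key)) ≤ ε * (1 + Real.logb 2 (Fintype.card P.Key)) :=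
    mul_le_mul_of_nonneg_right (by linarith)
      (add_nonneg zero_le_one (Real.logb_nonneg one_lt_two hcard))
  linarith

end KeyProtocol

end Protocol

section KeyRate

open Filter Topology

variable {𝒳 𝒴 𝒵 𝒥 : Type*} [Fintype 𝒳] [Fintype 𝒴] [Fintype 𝒵] [Fintype 𝒥]
  {p : 𝒳 × 𝒴 × 𝒵 → ℝ} {W : 𝒵 → 𝒥 → ℝ}

theorem IsAchievableKeyRate.one_sub_mul_le {R ε : ℝ} (hR : IsAchievableKeyRate p R)
    (hp : p ∈ stdSimplex ℝ (𝒳 × 𝒴 × 𝒵)) (hW : ∀ z, W z ∈ stdSimplex ℝ 𝒥) (hε : 0 < ε)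
    (hε' : ε ≤ 1) : (1 - ε) * R ≤ condMutualInfo (degrade p W) := by
  obtain ⟨N, hN⟩ := hR ε hε
  have hlimit : Tendsto (fun n : ℕ => condMutualInfo (degrade p W) + (Real.logb 2 3 + 2) / n)
      atTop (𝓝 (condMutualInfo (degrade p W))) := by
    simpa using tendsto_const_nhds.add (tendsto_const_div_atTop_nhds_zero_nat (Real.logb 2 3 + 2))
  refine ge_of_tendsto hlimit ?_
  filter_upwards [eventually_ge_atTop N, eventually_gt_atTop 0] with n hn hn₀
  obtain ⟨P, hagree, hsecret, hrate⟩ := hN n hn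
  have hn₀' : (0 : ℝ) < n := Nat.cast_pos.2 hn₀
  calc (1 - ε) * R
      ≤ (1 - ε) * (1 / n * Real.logb 2 (Fintype.card P.Key)) :=
        mul_le_mul_of_nonneg_left hrate (sub_nonneg.2 hε')
    _ = (1 - ε) * Real.logb 2 (Fintype.card P.Key) / n := by ring
    _ ≤ (n * condMutualInfo (degrade p W) + (Real.logb 2 3 + 2)) / n := by
        gcongr
        exact P.one_sub_mul_logb_card_le hp hW hε' hagree hsecret
    _ = condMutualInfo (degrade p W) + (Real.logb 2 3 + 2) / n := by
        rw [add_div, mul_div_cancel_left₀ _ hn₀'.ne']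

theorem IsAchievableKeyRate.le_condMutualInfo_degrade {R : ℝ} (hR : IsAchievableKeyRate p R)
    (hp : p ∈ stdSimplex ℝ (𝒳 × 𝒴 × 𝒵)) (hW : ∀ z, W z ∈ stdSimplex ℝ 𝒥) :
    R ≤ condMutualInfo (degrade p W) := by
  have hcont : Continuous fun ε : ℝ => (1 - ε) * R := by fun_prop
  have hlimit : Tendsto (fun ε : ℝ => (1 - ε) * R) (𝓝[>] 0) (𝓝 R) := by
    simpa using (hcont.tendsto 0).mono_left nhdsWithin_le_nhds
  refine le_of_tendsto hlimit ?_
  filter_upwards [Ioc_mem_nhdsGT zero_lt_one] with ε hε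
  exact hR.one_sub_mul_le hp hW hε.1 hε.2

theorem twoWayKeyRate_le_condMutualInfo_degrade (hp : p ∈ stdSimplex ℝ (𝒳 × 𝒴 × 𝒵))
    (hW : ∀ z, W z ∈ stdSimplex ℝ 𝒥) :
    twoWayKeyRate p ≤ (condMutualInfo (degrade p W) : EReal) :=
  sSup_le <| Set.forall_mem_image.2 fun _ hR =>
    EReal.coe_le_coe_iff.2 (hR.le_condMutualInfo_degrade hp hW)

end KeyRate

section SupportRelation

variable {α β : Type*} [Fintype α] [Fintype β] {q p : α × β → ℝ}

theorem SuppBelow.freshMass_eq_zero (h : SuppBelow q p) (hq : ∀ a, 0 ≤ q a) :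
    freshMass q p = 0 := by
  refine Finset.sum_eq_zero fun a _ => Set.indicator_apply_eq_zero.2 fun ha => ?_
  by_contra hne
  have hpos : 0 < q a := (hq a).lt_of_ne' hne
  rcases h with h | h
  · exact ha.1 (h.1 (hpos.trans_le (le_margFst hq a)))
  · exact ha.2 (h.1 (hpos.trans_le (le_margSnd hq a)))

theorem recombinedMass_pos (hq : ∀ a, 0 ≤ q a) {x : α} (hx : x ∈ supp (margFst p)) {y : β}
    (hy : y ∈ supp (margSnd p)) (hqxy : 0 < q (x, y)) (hpxy : p (x, y) = 0) :
    0 < recombinedMass q p := by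
  have hmem : (x, y) ∈ (supp (margFst p) ×ˢ supp (margSnd p)) \ supp p :=
    ⟨⟨hx, hy⟩, hpxy.not_gt⟩
  refine (hqxy.trans_eq (Set.indicator_of_mem hmem q).symm).trans_le ?_
  exact Finset.single_le_sum (fun a _ => Set.indicator_nonneg (fun b _ => hq b) a)
    (Finset.mem_univ (x, y))

end SupportRelation

section Main

variable {𝒳 𝒴 𝒵 : Type*} [Fintype 𝒳] [Fintype 𝒴] {p : 𝒳 × 𝒴 × 𝒵 → ℝ} {z₀ z₁ : 𝒵}

theorem margZ_pos_of_condXY_ne_zero {z : 𝒵} (hp : ∀ a, 0 ≤ p a) (h : condXY p z ≠ 0) :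
    0 < margZ p z :=
  (margZ_nonneg hp z).lt_of_ne' fun hz => h (funext fun a => by rw [condXY, hz, div_zero]; rfl)

theorem freshMass_slice_lt_recombinedMass_slice (hp : ∀ a, 0 ≤ p a)
    (h : freshMass (condXY p z₁) (condXY p z₀) < recombinedMass (condXY p z₁) (condXY p z₀)) :
    freshMass (slice p z₁) (slice p z₀) < recombinedMass (slice p z₁) (slice p z₀) := by
  have hcond₀ : condXY p z₀ ≠ 0 := fun hzero =>
    (sum_pos_of_freshMass_lt_recombinedMass (condXY_nonneg hp z₁) (condXY_nonneg hp z₀) h).ne'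
      (by simp [hzero])
  have hcond₁ : condXY p z₁ ≠ 0 := fun hzero => h.ne (by
    rw [hzero]
    simp [freshMass, recombinedMass])
  have hz₀ := margZ_pos_of_condXY_ne_zero hp hcond₀
  have hz₁ := margZ_pos_of_condXY_ne_zero hp hcond₁
  rw [← margZ_smul_condXY hp z₀, ← margZ_smul_condXY hp z₁, freshMass_smul_smul _ hz₀,
    recombinedMass_smul_smul _ hz₀]
  exact mul_lt_mul_of_pos_left h hz₁

theorem theorem3_general [Fintype 𝒵] (hp : p ∈ stdSimplex ℝ (𝒳 × 𝒴 × 𝒵))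
    (h : freshMass (condXY p z₁) (condXY p z₀) < recombinedMass (condXY p z₁) (condXY p z₀)) :
    twoWayKeyRate p < (condMutualInfo p : EReal) := by
  obtain ⟨W, hW, hlt⟩ := exists_condMutualInfo_degrade_lt hp.1
    (freshMass_slice_lt_recombinedMass_slice hp.1 h)
  exact (twoWayKeyRate_le_condMutualInfo_degrade hp hW).trans_lt (EReal.coe_lt_coe_iff.2 hlt)

end Main

theorem theorem3 {𝒳 𝒴 𝒵 : Type*} [Fintype 𝒳] [Fintype 𝒴] [Fintype 𝒵]
    (p : 𝒳 × 𝒴 × 𝒵 → ℝ) (hp : p ∈ stdSimplex ℝ (𝒳 × 𝒴 × 𝒵))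
    (z₀ z₁ : 𝒵) (hz : SuppBelow (condXY p z₁) (condXY p z₀))
    (hxy : ∃ x ∈ supp (margFst (condXY p z₀)), ∃ y ∈ supp (margSnd (condXY p z₀)),
      0 < condXY p z₁ (x, y) ∧ condXY p z₀ (x, y) = 0) :
    twoWayKeyRate p < (condMutualInfo p : EReal) := by
  obtain ⟨x, hx, y, hy, hxy₁, hxy₀⟩ := hxy
  have hq := condXY_nonneg hp.1 z₁
  exact theorem3_general hp
    ((hz.freshMass_eq_zero hq).trans_lt (recombinedMass_pos hq hx hy hxy₁ hxy₀))
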